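/- Let $n,k\ge 0$ be integers and $[n]=\{1,\dots,n\}$. Encode a set partition $\pi$ of $[n]$ with $d$ blocks by its canonical sequence $\pi_1\pi_2\cdots\pi_n$: number the blocks $1,\dots,d$ in increasing order of their smallest elements, and let $\pi_i$ be the number of the block that contains $i$. A partition $\pi$ of $[n]$ contains a sequence $\sigma_1\cdots\sigma_m$ if there are indices $1\le f(1)<\dots<f(m)\le n$ such that, for all $i,j\in[m]$, $\pi_{f(i)}<\pi_{f(j)}$ if and only if $\sigma_i<\sigma_j$; otherwise $\pi$ avoids this sequence. Call $\pi$ $k$-noncrossing if it avoids $12\cdots k\,12\cdots k$, and $k$-nonnesting if it avoids $12\cdots k\,k(k-1)\cdots 1$. Then, for every $n$ and $k$, the number of $k$-noncrossing partitions of $[n]$ is equal to the number of $k$-nonnesting partitions of $[n]$. Moreover, for every $n$ and $k$ there is a bijection from the $k$-noncrossing partitions of $[n]$ onto the $k$-nonnesting partitions of $[n]$ that preserves the number of blocks, the size of each block and the smallest element of each block: if $\pi$ is mapped to $\pi'$, then $\pi$ and $\pi'$ have the same number of blocks, and for every block $B$ of $\pi$ there is a block $B'$ of $\pi'$ with $|B'|=|B|$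 and $\min B'=\min B$. -/

import Mathlib

/-- The set partitions of `[n]`, realised as the partitions of the `n`-element linearly ordered
type `Fin n` (whose elements `0 < 1 < ⋯ < n - 1` stand for `1 < 2 < ⋯ < n`). -/
abbrev SetPartition (n : ℕ) : Type := Finpartition (Finset.univ : Finset (Fin n))

namespace SetPartition

/-- The canonical sequence of a set partition `π`. The blocks are numbered `1, 2, …, d` by
increasing minimal element, and the `i`-th entry is the number of the block that contains `i`;
this number counts the blocks whose minimum does not exceed the minimum of the block of `i`. -/
def canonicalSeq {n : ℕ} (π : SetPartition n) (i : Fin n) : ℕ :=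
  (π.parts.filter fun B => B.min ≤ (π.part i).min).card

/-- `π` contains the pattern `s` (a finite sequence of numbers): the canonical sequence of `π` has
a subsequence that is order-isomorphic to `s`. -/
def Contains {n m : ℕ} (π : SetPartition n) (s : Fin m → ℕ) : Prop :=
  ∃ f : Fin m → Fin n, StrictMono f ∧
    ∀ i j : Fin m, π.canonicalSeq (f i) < π.canonicalSeq (f j) ↔ s i < s j

/-- `π` avoids the pattern `s`. -/
def Avoids {n m : ℕ} (π : SetPartition n) (s : Fin m → ℕ) : Prop :=
  ¬ π.Contains s

end SetPartition

/-- The sequence `1 2 ⋯ k 1 2 ⋯ k`. -/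
def crossingPattern (k : ℕ) : Fin (k + k) → ℕ :=
  Fin.append (fun i : Fin k => (i : ℕ) + 1) (fun i : Fin k => (i : ℕ) + 1)

/-- The sequence `1 2 ⋯ k k (k-1) ⋯ 1`. -/
def nestingPattern (k : ℕ) : Fin (k + k) → ℕ :=
  Fin.append (fun i : Fin k => (i : ℕ) + 1) (fun i : Fin k => (i.rev : ℕ) + 1)

namespace SetPartition

/-- `π` is `k`-noncrossing: it avoids `1 2 ⋯ k 1 2 ⋯ k`. -/
def IsNoncrossing {n : ℕ} (k : ℕ) (π : SetPartition n) : Prop :=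
  π.Avoids (crossingPattern k)

/-- `π` is `k`-nonnesting: it avoids `1 2 ⋯ k k (k-1) ⋯ 1`. -/
def IsNonnesting {n : ℕ} (k : ℕ) (π : SetPartition n) : Prop :=
  π.Avoids (nestingPattern k)

end SetPartition

/-! Write a partition as the word of its block numbers, and let its profile record the block minima
together with the block sizes. The first half of a `k`-crossing or `k`-nesting can be moved to block
minima. So for `k > 0` a partition is `k`-noncrossing iff, for every `i` that is not a block
minimum, the letters at non-minima from `i` on that belong to blocks opened before `i` contain no
strictly increasing subsequence of length `k`. It is `k`-nonnesting iff they contain no strictly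
decreasing one.

Insert these letters into a semistandard tableau, the last letter first. Under row insertion the
number of rows is the length of a longest strictly increasing subsequence of the word
(`topShape_row_tableau_eq_zero_iff`); under column insertion it is that of a longest strictly
decreasing one (`topShape_column_tableau_eq_zero_iff`). Both conditions thus say that certain shapes
have fewer than `k` rows.

Both insertions are bijections between pairs (tableau, letter) and pairs (tableau, corner), and both
commute with discarding the largest letters. Fix a profile and a tableau `T`, and sort the words
with this profile and tableau. If the profile starts with a non-minimum, sort them by the corner
that undoing the last insertion removes from `T`. If it starts with the minimum of a block of size
`s`, sort them by the horizontal strip of `s - 1` boxes that the new letter adds to `T`. The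
possible corners and strips depend only on the shape of `T`. By induction the number of words
depends only on profile and shape, not on the insertion rule (`nonempty_fiber_equiv`). The empty
tableau gives a bijection for each profile; these are glued together. -/

/-! ### Shapes and horizontal strips -/

/-- Row lengths of a Young diagram. -/
abbrev RowLengths : Type := ℕ → ℕ

namespace RowLengths

def addBox (s : RowLengths) (b : ℕ) : RowLengths := fun i => if i = b then s i + 1 else s i

def removeBox (s : RowLengths) (b : ℕ) : RowLengths := fun i => if i = b then s i - 1 else s i

/-- Add a box in the given row, if any. -/
def addBox? (s : RowLengths) : Option ℕ → RowLengths
  | none => s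
  | some a => s.addBox a

/-- Remove a box from the given row, if any. -/
def removeBox? (s : RowLengths) : Option ℕ → RowLengths
  | none => s
  | some a => s.removeBox a

def Addable (s : RowLengths) (a : ℕ) : Prop := ∀ i, i + 1 = a → s a < s i

def Removable (s : RowLengths) (b : ℕ) : Prop := s (b + 1) < s b

/-- `s / r` is a horizontal strip. -/
def HStrip (r s : RowLengths) : Prop := ∀ i, r i ≤ s i ∧ s (i + 1) ≤ r i

theorem addBox?_none_apply (s : RowLengths) (i : ℕ) : s.addBox? none i = s i := rfl

theorem addBox?_some_apply (s : RowLengths) (a i : ℕ) :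
    s.addBox? (some a) i = if i = a then s i + 1 else s i := rfl

theorem removeBox?_none_apply (s : RowLengths) (i : ℕ) : s.removeBox? none i = s i := rfl

theorem removeBox?_some_apply (s : RowLengths) (a i : ℕ) :
    s.removeBox? (some a) i = if i = a then s i - 1 else s i := rfl

theorem removeBox_addBox (s : RowLengths) (b : ℕ) : (s.addBox b).removeBox b = s := by
  funext i
  simp only [addBox, removeBox]
  split_ifs <;> omega

theorem addBox_removeBox {s : RowLengths} {b : ℕ} (h : s.Removable b) :
    (s.removeBox b).addBox b = s := by
  funext i
  simp only [addBox, removeBox, Removable] at *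
  split_ifs with hi
  · subst hi; omega
  · rfl

end RowLengths

/-! ### Insertion into chains of shapes by local rules -/

open RowLengths in
/-- A local rule for inserting letters into a semistandard tableau, the latter being regarded as a
chain of shapes. If `s / r` is a horizontal strip and `r` grows by a box in row `o` (`o = none`
meaning that the inserted letter is the largest one), then `s` grows by a box in row
`push N r s o`, where `N` bounds the number of rows of `r`; the map `pull` undoes this. -/
structure InsertionRule where
  push : ℕ → RowLengths → RowLengths → Option ℕ → ℕ
  pull : RowLengths → RowLengths → ℕ → Option ℕ
  push_strip : ∀ {N r s o}, r N = 0 → HStrip r s → (∀ a ∈ o, r.Addable a) →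
    HStrip (r.addBox? o) (s.addBox (push N r s o))
  pull_push : ∀ {N r s o}, r N = 0 → HStrip r s → (∀ a ∈ o, r.Addable a) →
    pull (r.addBox? o) (s.addBox (push N r s o)) (push N r s o) = o
  pull_strip : ∀ {r s b}, HStrip r s → s.Removable b →
    (∀ a ∈ pull r s b, r.Removable a) ∧ HStrip (r.removeBox? (pull r s b)) (s.removeBox b)
  push_pull : ∀ {N r s b}, r N = 0 → HStrip r s → s.Removable b →
    push N (r.removeBox? (pull r s b)) (s.removeBox b) (pull r s b) = b

/-- The largest shape of a chain of shapes. -/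
def topShape : List RowLengths → RowLengths
  | [] => 0
  | s :: _ => s

@[simp] theorem topShape_nil : topShape [] = 0 := rfl

@[simp] theorem topShape_cons (s : RowLengths) (T : List RowLengths) : topShape (s :: T) = s := rfl

/-- A semistandard tableau, encoded as a chain of shapes with the largest one first. -/
def IsTableau : List RowLengths → Prop
  | [] => True
  | s :: T => RowLengths.HStrip (topShape T) s ∧ IsTableau T

theorem isTableau_cons {s : RowLengths} {T : List RowLengths} :
    IsTableau (s :: T) ↔ RowLengths.HStrip (topShape T) s ∧ IsTableau T := Iff.rfl

theorem IsTableau.topShape_eq_zero {T : List RowLengths} (h : IsTableau T) :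
    ∀ {i : ℕ}, T.length ≤ i → topShape T i = 0 := by
  induction T with
  | nil => intro i _; rfl
  | cons s T ih =>
    intro i hi
    obtain ⟨h1, h2⟩ := isTableau_cons.1 h
    obtain ⟨i, rfl⟩ : ∃ j, i = j + 1 := ⟨i - 1, by simp at hi; omega⟩
    have := (h1 i).2
    have := ih h2 (i := i) (by simpa using hi)
    simp only [topShape_cons]
    omega

theorem IsTableau.topShape_succ_le {T : List RowLengths} (h : IsTableau T) (i : ℕ) :
    topShape T (i + 1) ≤ topShape T i := by
  cases T with
  | nil => exact le_rfl
  | cons s T =>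
    have := (isTableau_cons.1 h).1 i
    simp only [topShape_cons]
    omega

theorem IsTableau.topShape_antitone {T : List RowLengths} (h : IsTableau T) :
    Antitone (topShape T) :=
  antitone_nat_of_succ_le h.topShape_succ_le

theorem isTableau_replicate (h : ℕ) : IsTableau (List.replicate h 0) := by
  induction h with
  | zero => trivial
  | succ h ih =>
    refine isTableau_cons.2 ⟨?_, ih⟩
    intro i
    cases h <;> simp [List.replicate_succ]

theorem topShape_replicate (h : ℕ) : topShape (List.replicate h 0) = 0 := by
  cases h <;> simp [List.replicate_succ]

theorem IsTableau.eq_replicate {T : List RowLengths} (h : IsTableau T) (h0 : topShape T = 0) :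
    T = List.replicate T.length 0 := by
  induction T with
  | nil => rfl
  | cons s T ih =>
    obtain ⟨h1, h2⟩ := isTableau_cons.1 h
    simp only [topShape_cons] at h0
    subst h0
    have : topShape T = 0 := by
      funext i
      have := (h1 i).1
      simpa using this
    rw [List.length_cons, List.replicate_succ, ← ih h2 this]

namespace InsertionRule

variable (R : InsertionRule)

/-- Insert the letter `x` into a tableau; also return the row in which the shape grows. -/
def insert : List RowLengths → ℕ → List RowLengths × ℕ
  | [], _ => ([], 0)
  | s :: T, x =>
    if x = T.length then
      (s.addBox (R.push T.length (topShape T) s none) :: T, R.push T.length (topShape T) s none)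
    else
      (s.addBox (R.push T.length (topShape T) s (some (insert T x).2)) :: (insert T x).1,
        R.push T.length (topShape T) s (some (insert T x).2))

/-- Undo an insertion after which the shape has grown in row `b`. -/
def extract : List RowLengths → ℕ → List RowLengths × ℕ
  | [], _ => ([], 0)
  | s :: T, b =>
    match R.pull (topShape T) s b with
    | none => (s.removeBox b :: T, T.length)
    | some a => (s.removeBox b :: (extract T a).1, (extract T a).2)

/-- The local rule carries the growth from each shape of the chain to the next larger one.
Extraction runs back from the largest shape, `pull` recovering the row in which the next smaller
shape grew; it stops with `none` at the letter that was inserted. -/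
theorem insert_spec {T : List RowLengths} (hT : IsTableau T) {x : ℕ} (hx : x < T.length) :
    IsTableau (R.insert T x).1 ∧ (R.insert T x).1.length = T.length ∧
      topShape (R.insert T x).1 = (topShape T).addBox (R.insert T x).2 ∧
      (topShape T).Addable (R.insert T x).2 ∧
      R.extract (R.insert T x).1 (R.insert T x).2 = (T, x) := by
  induction T with
  | nil => simp at hx
  | cons s T ih =>
    obtain ⟨h1, h2⟩ := isTableau_cons.1 hT
    have h0 := h2.topShape_eq_zero (i := T.length) le_rfl
    -- With `i` the row above `b`, the new strip forces `s b + 1 ≤ r i ≤ s i`.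
    have addable : ∀ {r : RowLengths} {b : ℕ}, RowLengths.HStrip r (s.addBox b) →
        s.Addable b := by
      intro r b h i hi
      have h3 := (h i).2
      have h4 := (h i).1
      rw [hi] at h3
      simp only [RowLengths.addBox, if_true] at h3 h4
      rw [if_neg (by omega)] at h4
      omega
    by_cases hxT : x = T.length
    · have hs := R.push_strip (o := none) h0 h1 (by simp)
      have hp := R.pull_push (o := none) h0 h1 (by simp)
      simp only [RowLengths.addBox?] at hs hp
      simp only [insert, hxT, if_true]
      refine ⟨isTableau_cons.2 ⟨hs, h2⟩, by simp, rfl, addable hs, ?_⟩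
      simp only [extract, hp, RowLengths.removeBox_addBox]
    · obtain ⟨i1, i2, i3, i4, i5⟩ := ih h2 (by simp at hx; omega)
      have hs := R.push_strip (o := some (R.insert T x).2) h0 h1 (by simpa using i4)
      have hp := R.pull_push (o := some (R.insert T x).2) h0 h1 (by simpa using i4)
      simp only [RowLengths.addBox?, ← i3] at hs hp
      simp only [insert, hxT, if_false]
      refine ⟨isTableau_cons.2 ⟨hs, i1⟩, by simp [i2], rfl, addable hs, ?_⟩
      simp only [extract, hp, RowLengths.removeBox_addBox, i5]

theorem extract_spec {T : List RowLengths} (hT : IsTableau T) {b : ℕ}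
    (hb : (topShape T).Removable b) :
    IsTableau (R.extract T b).1 ∧ (R.extract T b).1.length = T.length ∧
      topShape (R.extract T b).1 = (topShape T).removeBox b ∧
      (R.extract T b).2 < T.length ∧
      R.insert (R.extract T b).1 (R.extract T b).2 = (T, b) := by
  induction T generalizing b with
  | nil => simp [RowLengths.Removable] at hb
  | cons s T ih =>
    obtain ⟨h1, h2⟩ := isTableau_cons.1 hT
    have h0 := h2.topShape_eq_zero (i := T.length) le_rfl
    simp only [topShape_cons] at hb
    obtain ⟨hs, hs'⟩ := R.pull_strip h1 hb
    have hp := R.push_pull h0 h1 hb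
    cases ho : R.pull (topShape T) s b with
    | none =>
      simp only [ho, RowLengths.removeBox?] at hs hs' hp
      simp only [extract, ho]
      refine ⟨isTableau_cons.2 ⟨hs', h2⟩, by simp, rfl, by simp, ?_⟩
      simp only [insert, if_true, hp, RowLengths.addBox_removeBox hb]
    | some a =>
      simp only [ho, RowLengths.removeBox?] at hs hs' hp
      obtain ⟨i1, i2, i3, i4, i5⟩ := ih h2 (hs a (by simp))
      simp only [extract, ho]
      refine ⟨isTableau_cons.2 ⟨i3 ▸ hs', i1⟩, by simp [i2], rfl, by simp; omega, ?_⟩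
      simp only [insert, i2, i4.ne, if_false, i5, i3, hp, RowLengths.addBox_removeBox hb]

/-- The insertion tableau of a word with letters below `h`, inserted from the last letter on. -/
def tableau (h : ℕ) : List ℕ → List RowLengths
  | [] => List.replicate h 0
  | x :: u => (R.insert (tableau h u) x).1

theorem tableau_spec {h : ℕ} {u : List ℕ} (hu : ∀ x ∈ u, x < h) :
    IsTableau (R.tableau h u) ∧ (R.tableau h u).length = h := by
  induction u with
  | nil => exact ⟨isTableau_replicate h, by simp [tableau]⟩
  | cons x u ih =>
    obtain ⟨i1, i2⟩ := ih fun y hy => hu y (by simp [hy])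
    have := R.insert_spec i1 (x := x) (by rw [i2]; exact hu x (by simp))
    exact ⟨this.1, by rw [tableau, this.2.1, i2]⟩

theorem sum_topShape_tableau {h : ℕ} {u : List ℕ} (hu : ∀ x ∈ u, x < h) :
    ∑ i ∈ Finset.range h, topShape (R.tableau h u) i = u.length := by
  induction u with
  | nil => simp [tableau, topShape_replicate]
  | cons x u ih =>
    have hu' : ∀ y ∈ u, y < h := fun y hy => hu y (by simp [hy])
    obtain ⟨i1, i2⟩ := R.tableau_spec hu'
    obtain ⟨j1, j2, j3, -⟩ := R.insert_spec i1 (x := x) (by rw [i2]; exact hu x (by simp))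
    set b := (R.insert (R.tableau h u) x).2
    have hb : b < h := by
      by_contra hb
      have := j1.topShape_eq_zero (i := b) (by omega)
      rw [j3] at this
      simp [RowLengths.addBox] at this
    have key : ∀ i, topShape (R.tableau h u) i + (if i = b then 1 else 0) =
        (topShape (R.tableau h u)).addBox b i := by
      intro i
      simp only [RowLengths.addBox]
      split_ifs <;> rfl
    rw [tableau, j3, List.length_cons, ← ih hu', ← Finset.sum_congr rfl fun i _ => key i,
      Finset.sum_add_distrib, Finset.sum_ite_eq', if_pos (by simpa using hb)]

/-- The largest letter `h` occupies only the outermost strip, so inserting it leaves the smaller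
shapes alone, and these never look at the outermost one. -/
theorem tail_tableau {h : ℕ} {u : List ℕ} (hu : ∀ x ∈ u, x < h + 1) :
    (R.tableau (h + 1) u).tail = R.tableau h (u.filter (· < h)) := by
  induction u with
  | nil => simp [tableau, List.replicate_succ]
  | cons x u ih =>
    have hu' : ∀ y ∈ u, y < h + 1 := fun y hy => hu y (by simp [hy])
    obtain ⟨i1, i2⟩ := R.tableau_spec hu'
    have ih := ih hu'
    have hx := hu x (by simp)
    match hT : R.tableau (h + 1) u with
    | [] => simp [hT] at i2
    | s :: T =>
      have hl : T.length = h := by simpa [hT] using i2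
      rw [hT] at ih
      simp only [List.tail_cons] at ih
      by_cases hxh : x = h
      · simp [tableau, hT, insert, hl, hxh, ← ih]
      · have : x < h := by omega
        simp [tableau, hT, insert, hl, hxh, ← ih, this]

end InsertionRule

/-! ### Row and column insertion as local rules -/

namespace InsertionRule

open RowLengths

/-- Row insertion: a box added to row `a` leads to a box in the same row or, if that box is already
taken by the strip, in the next row. -/
def rowPush (r s : RowLengths) : Option ℕ → ℕ
  | none => 0
  | some a => if s a = r a then a else a + 1
/-- The inverse of `rowPush`. -/
def rowPull (r s : RowLengths) (b : ℕ) : Option ℕ :=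
  if r b = s b then some b else if b = 0 then none else some (b - 1)

/-- The local rule of row insertion. -/
def row : InsertionRule where
  push _ := rowPush
  pull := rowPull
  push_strip {N r s o} h0 h ho i := by
    have h1 := h i
    cases o with
    | none => grind [addBox, addBox?_none_apply, addBox?_some_apply, rowPush]
    | some a =>
      have ha := ho a rfl i
      have h2 := h a
      grind [addBox, addBox?_none_apply, addBox?_some_apply, rowPush]
  pull_push {N r s o} h0 h ho := by
    cases o with
    | none =>
      have h1 := h 0
      grind [addBox, addBox?_none_apply, addBox?_some_apply, rowPush, rowPull]
    | some a =>
      have ha := h a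
      have ha' := h (a + 1)
      grind [addBox, addBox?_none_apply, addBox?_some_apply, rowPush, rowPull]
  pull_strip {r s b} h hb := by
    have h1 := h b
    have h2 := h (b + 1)
    have h3 := h (b - 1)
    refine ⟨?_, fun i => ?_⟩
    · grind [Removable, rowPull]
    · have h4 := h i
      grind [removeBox, removeBox?_none_apply, removeBox?_some_apply, rowPull, Removable]
  push_pull {N r s b} h0 h hb := by
    have h1 := h b
    have h2 := h (b - 1)
    grind [removeBox, removeBox?_none_apply, removeBox?_some_apply, rowPull, Removable, rowPush]
open Classical in
/-- Column insertion: a new box moves up to the highest row that leads to a horizontal strip, as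
long as all rows passed are filled up by the strip. -/
noncomputable def column : InsertionRule where
  push N r s o := Nat.findGreatest (fun b => ∀ i, i + 1 = b → s b < r i) (o.getD N)
  pull r s b := if h : ∃ a, b ≤ a ∧ s (a + 1) < r a then some (Nat.find h) else none
  push_strip {N r s o} h0 h ho := by
    set b := Nat.findGreatest (fun b => ∀ i, i + 1 = b → s b < r i) (o.getD N) with hbdef
    have hQ : ∀ i, i + 1 = b → s b < r i :=
      Nat.findGreatest_spec (P := fun b => ∀ i, i + 1 = b → s b < r i) (Nat.zero_le _) (by simp)
    have hle : b ≤ o.getD N := Nat.findGreatest_le _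
    have hmax : ∀ j, b ≤ j → j + 1 ≤ o.getD N → r j ≤ s (j + 1) := by
      intro j hj hj'
      have := Nat.findGreatest_is_greatest (P := fun b => ∀ i, i + 1 = b → s b < r i)
        (n := o.getD N) (k := j + 1) (by omega) hj'
      simpa using this
    clear_value b
    intro i
    have h1 := h i
    cases o with
    | none =>
      have := hQ i
      grind [addBox, addBox?_none_apply]
    | some a =>
      simp only [Option.getD_some] at hle hmax
      have ha := ho a rfl
      simp only [addBox?, addBox]
      have h2 := hQ i
      refine ⟨?_, ?_⟩
      · split_ifs with c1 c2 c2
        · omega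
        · subst c1
          -- Here `b < a`, so row `a` was passed as full: `s a ≥ r (a - 1) > r a` already has room
          -- for the box added to `r`.
          obtain ⟨j, rfl⟩ : ∃ j, i = j + 1 := ⟨i - 1, by omega⟩
          have := hmax j (by omega) (by omega)
          have := ha j rfl
          omega
        · omega
        · omega
      · split_ifs with c1 c2 c2
        · subst c1; omega
        · subst c1; have := h2 rfl; omega
        · omega
        · omega
  pull_push {N r s o} h0 h ho := by
    set b := Nat.findGreatest (fun b => ∀ i, i + 1 = b → s b < r i) (o.getD N) with hbdef
    have hle : b ≤ o.getD N := Nat.findGreatest_le _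
    have hmax : ∀ j, b ≤ j → j + 1 ≤ o.getD N → r j ≤ s (j + 1) := by
      intro j hj hj'
      have := Nat.findGreatest_is_greatest (P := fun b => ∀ i, i + 1 = b → s b < r i)
        (n := o.getD N) (k := j + 1) (by omega) hj'
      simpa using this
    clear_value b
    have hanti : Antitone r := antitone_nat_of_succ_le fun i =>
      ((h (i + 1)).1.trans (h i).2)
    cases o with
    | none =>
      -- All rows from `b` up to `N` were passed as full, and beyond them `r` vanishes, so the
      -- search of `pull` fails.
      rw [dif_neg]
      rintro ⟨j, hj, hj'⟩
      simp only [addBox?, addBox, Option.getD_none] at hj' hle hmax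
      rw [if_neg (by omega)] at hj'
      by_cases hjN : j + 1 ≤ N
      · have := hmax j hj hjN
        omega
      · have := hanti (show N ≤ j by omega)
        omega
    | some a =>
      simp only [Option.getD_some] at hle hmax
      have hP : ∃ j, b ≤ j ∧ s.addBox b (j + 1) < r.addBox? (some a) j := by
        refine ⟨a, hle, ?_⟩
        have := h a
        simp only [addBox?, addBox, if_true]
        rw [if_neg (by omega)]
        omega
      rw [dif_pos hP]
      congr 1
      rw [Nat.find_eq_iff]
      constructor
      · refine ⟨hle, ?_⟩
        have := h a
        simp only [addBox?, addBox, if_true]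
        rw [if_neg (by omega)]
        omega
      · rintro j hj ⟨hj1, hj2⟩
        simp only [addBox?, addBox] at hj2
        rw [if_neg (by omega), if_neg (by omega)] at hj2
        have := hmax j hj1 (by omega)
        omega
  pull_strip {r s b} h hb := by
    have hb' : s (b + 1) < s b := hb
    by_cases hP : ∃ a, b ≤ a ∧ s (a + 1) < r a
    · simp only [dif_pos hP, Option.mem_some_iff, forall_eq', removeBox?]
      obtain ⟨ha, ha'⟩ := Nat.find_spec hP
      have hmin : ∀ j, j < Nat.find hP → b ≤ j → r j ≤ s (j + 1) := by
        intro j hj hj'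
        have := Nat.find_min hP hj
        simpa [hj'] using this
      generalize Nat.find hP = a at *
      refine ⟨?_, fun i => ?_⟩
      · have := h (a + 1)
        simp only [Removable]
        omega
      · have h1 := h i
        have := hmin i
        have := hmin b
        grind [removeBox]
    · simp only [dif_neg hP, removeBox?]
      push Not at hP
      refine ⟨by simp, fun i => ?_⟩
      have h1 := h i
      have := hP i
      grind [removeBox]
  push_pull {N r s b} h0 h hb := by
    have hb' : s (b + 1) < s b := hb
    have hanti : Antitone r := antitone_nat_of_succ_le fun i =>
      ((h (i + 1)).1.trans (h i).2)
    rw [Nat.findGreatest_eq_iff]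
    by_cases hP : ∃ a, b ≤ a ∧ s (a + 1) < r a
    · simp only [dif_pos hP, Option.getD_some, removeBox?]
      obtain ⟨ha, ha'⟩ := Nat.find_spec hP
      have hmin : ∀ j, j < Nat.find hP → b ≤ j → r j ≤ s (j + 1) := by
        intro j hj hj'
        have := Nat.find_min hP hj
        simpa [hj'] using this
      generalize Nat.find hP = a at *
      refine ⟨ha, fun _ i hi => ?_, fun {n} hn hn' hn'' => ?_⟩
      · subst hi
        have := (h i).2
        simp only [removeBox]
        split_ifs <;> omega
      · obtain ⟨j, rfl⟩ : ∃ j, n = j + 1 := ⟨n - 1, by omega⟩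
        have := hn'' j rfl
        have := hmin j (by omega) (by omega)
        simp only [removeBox] at *
        split_ifs at * <;> omega
    · simp only [dif_neg hP, Option.getD_none, removeBox?]
      push Not at hP
      refine ⟨?_, fun _ i hi => ?_, fun {n} hn hn' hn'' => ?_⟩
      -- If `N < b`, then `s b ≤ r (b - 1) ≤ r N = 0`, and row `b` would have no box to remove.
      · by_contra hN
        have := (h (b - 1)).2
        rw [Nat.sub_add_cancel (by omega)] at this
        have := hanti (show N ≤ b - 1 by omega)
        omega
      · subst hi
        have := (h i).2
        simp only [removeBox]
        split_ifs <;> omega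
      · obtain ⟨j, rfl⟩ : ∃ j, n = j + 1 := ⟨n - 1, by omega⟩
        have := hn'' j rfl
        have := hP j (by omega)
        simp only [removeBox] at *
        split_ifs at * <;> omega

end InsertionRule

/-! ### Words with a given profile, sorted by insertion tableau -/

open RowLengths

/-- The letters of `w` at the positions where the profile `Φ` does not open a block. -/
def innerWord : List (Option ℕ) → List ℕ → List ℕ
  | none :: Φ, x :: w => x :: innerWord Φ w
  | some _ :: Φ, _ :: w => innerWord Φ w
  | _, _ => []

/-- `w` is the end of a canonical sequence, after `h` blocks have been opened. The profile `Φ`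
prescribes the positions at which the remaining blocks are opened as well as their sizes. For each
other position, the inner word from there on, restricted to the letters of the blocks opened
before, satisfies `ok`. -/
def HasProfile (ok : ℕ → List ℕ → Prop) : ℕ → List (Option ℕ) → List ℕ → Prop
  | _, [], [] => True
  | h, none :: Φ, x :: w =>
    HasProfile ok h Φ w ∧ x < h ∧ ok h (x :: (innerWord Φ w).filter (· < h))
  | h, some s :: Φ, x :: w =>
    HasProfile ok (h + 1) Φ w ∧ x = h ∧ (innerWord Φ w).count h + 1 = s
  | _, _, _ => False

namespace InsertionRule

/-- The insertion tableau of the word has at most `K` rows. -/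
def Short (R : InsertionRule) (K h : ℕ) (u : List ℕ) : Prop := topShape (R.tableau h u) K = 0

/-- The sequences with given profile whose insertion tableau is `T`. -/
def Fiber (R : InsertionRule) (K h : ℕ) (Φ : List (Option ℕ)) (T : List RowLengths) : Type :=
  {w : List ℕ // HasProfile (R.Short K) h Φ w ∧
    R.tableau h ((innerWord Φ w).filter (· < h)) = T}

theorem mem_filter_lt (h : ℕ) (l : List ℕ) : ∀ x ∈ l.filter (· < h), x < h := by
  simp

/-- The first letter is the last one inserted, so undoing its insertion splits the words according
to the corner `b` that disappears. The condition at this position concerns only the shape of `T`,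
hence the same for all `b`. -/
theorem nonempty_fiber_none_equiv (R : InsertionRule) {K h : ℕ} (Φ : List (Option ℕ))
    {T : List RowLengths} (hT : IsTableau T) (hl : T.length = h) {t : RowLengths}
    (ht : topShape T = t) (hK : t K = 0) :
    Nonempty ((Σ b : {b : ℕ // t.Removable b}, R.Fiber K h Φ (R.extract T b).1) ≃
      R.Fiber K h (none :: Φ) T) := by
  subst ht
  refine ⟨Equiv.ofBijective (fun p => ⟨(R.extract T p.1).2 :: p.2.1, ?_⟩) ⟨?_, ?_⟩⟩
  · obtain ⟨⟨b, hb⟩, ⟨w, hw, hwT⟩⟩ := p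
    obtain ⟨i1, i2, i3, i4, i5⟩ := R.extract_spec hT hb
    simp only at hwT ⊢
    have h1 : R.tableau h ((R.extract T b).2 :: (innerWord Φ w).filter (· < h)) = T := by
      rw [tableau, hwT, i5]
    refine ⟨⟨hw, by omega, ?_⟩, ?_⟩
    · rw [Short, h1, hK]
    · rw [innerWord, List.filter_cons_of_pos (by simp; omega), h1]
  · rintro ⟨⟨b, hb⟩, ⟨w, hw, hwT⟩⟩ ⟨⟨b', hb'⟩, ⟨w', hw', hwT'⟩⟩ he
    obtain ⟨i1, i2, i3, i4, i5⟩ := R.extract_spec hT hb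
    obtain ⟨j1, j2, j3, j4, j5⟩ := R.extract_spec hT hb'
    have he := congrArg Subtype.val he
    obtain ⟨he1, he2⟩ := List.cons.inj he
    simp only at hwT hwT' he1 he2
    subst he2
    rw [← hwT, he1] at i5
    rw [← hwT', i5] at j5
    obtain rfl : b = b' := (Prod.mk.inj j5).2
    rfl
  · rintro ⟨w, hw, hwT⟩
    match w with
    | [] => simp [HasProfile] at hw
    | x :: w =>
      obtain ⟨hw1, hw2, hw3⟩ := hw
      rw [innerWord, List.filter_cons_of_pos (by simpa using hw2), tableau] at hwT
      obtain ⟨i1, i2⟩ := R.tableau_spec (mem_filter_lt h (innerWord Φ w))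
      obtain ⟨j1, j2, j3, j4, j5⟩ := R.insert_spec i1 (x := x) (by rw [i2]; exact hw2)
      generalize hb : (R.insert (R.tableau h ((innerWord Φ w).filter (· < h))) x).2 = b at *
      rw [hwT] at j5 j3
      have hrem : (topShape T).Removable b := by
        have := i1.topShape_succ_le b
        rw [j3]
        simp only [Removable, addBox, if_true]
        rw [if_neg (by omega)]
        omega
      refine ⟨⟨⟨b, hrem⟩, ⟨w, hw1, ?_⟩⟩, ?_⟩
      · rw [j5]
      · exact Subtype.ext (by simp only [j5])

/-- From here on the letter `h` is allowed, so the tableau gains one more shape `m`. The strip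
between `T` and `m` holds the copies of `h` in the inner word; there are `s - 1` of them, since the
block minimum is not part of that word. -/
theorem nonempty_fiber_some_equiv (R : InsertionRule) {K h : ℕ} (s : ℕ) (Φ : List (Option ℕ))
    {T : List RowLengths} (hT : IsTableau T) (hl : T.length = h) {t : RowLengths}
    (ht : topShape T = t) :
    Nonempty ((Σ m : {m : RowLengths // HStrip t m ∧
        ∑ i ∈ Finset.range (h + 1), m i + 1 = ∑ i ∈ Finset.range (h + 1), t i + s},
        R.Fiber K (h + 1) Φ (m.1 :: T)) ≃ R.Fiber K h (some s :: Φ) T) := by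
  subst ht
  have hfilter : ∀ w : List ℕ, ((innerWord Φ w).filter (· < h + 1)).filter (· < h) =
      (innerWord Φ w).filter (· < h) := by
    intro w
    rw [List.filter_filter]
    congr 1
    funext x
    simp
    omega
  have hcount : ∀ l : List ℕ, (l.filter (· < h + 1)).length = (l.filter (· < h)).length +
      l.count h := by
    intro l
    induction l with
    | nil => simp
    | cons x l ih =>
      simp only [List.filter_cons, List.count_cons, decide_eq_true_eq, beq_iff_eq]
      split_ifs <;> grind
  have hsum : ∀ w m, R.tableau (h + 1) ((innerWord Φ w).filter (· < h + 1)) = m :: T →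
      ∑ i ∈ Finset.range (h + 1), m i =
        ∑ i ∈ Finset.range (h + 1), topShape T i + (innerWord Φ w).count h := by
    intro w m hw
    have h1 := R.sum_topShape_tableau (mem_filter_lt (h + 1) (innerWord Φ w))
    have h2 := R.tail_tableau (mem_filter_lt (h + 1) (innerWord Φ w))
    have h3 := R.sum_topShape_tableau (mem_filter_lt h (innerWord Φ w))
    rw [hfilter, hw, List.tail_cons] at h2
    rw [hw, topShape_cons] at h1
    rw [h1, h2, Finset.sum_range_succ, h3, hcount, ← h2, hT.topShape_eq_zero hl.le, add_zero]
  refine ⟨Equiv.ofBijective (fun p => ⟨h :: p.2.1, ?_⟩) ⟨?_, ?_⟩⟩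
  · obtain ⟨⟨m, hm, hms⟩, ⟨w, hw, hwT⟩⟩ := p
    have h2 := R.tail_tableau (mem_filter_lt (h + 1) (innerWord Φ w))
    have h3 := hsum w m hwT
    rw [hfilter, hwT, List.tail_cons] at h2
    refine ⟨⟨hw, rfl, ?_⟩, ?_⟩
    · simp only
      omega
    · simp only [innerWord, h2]
  · rintro ⟨⟨m, hm, hms⟩, ⟨w, hw, hwT⟩⟩ ⟨⟨m', hm', hms'⟩, ⟨w', hw', hwT'⟩⟩ he
    have he2 := (List.cons.inj (congrArg Subtype.val he)).2
    simp only at hwT hwT' he2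
    subst he2
    obtain rfl : m = m' := by
      rw [hwT] at hwT'
      exact (List.cons.inj hwT').1
    rfl
  · rintro ⟨w, hw, hwT⟩
    match w with
    | [] => simp [HasProfile] at hw
    | x :: w =>
      obtain ⟨hw1, rfl, hw3⟩ := hw
      rw [innerWord] at hwT
      obtain ⟨i1, i2⟩ := R.tableau_spec (mem_filter_lt (x + 1) (innerWord Φ w))
      have h2 := R.tail_tableau (mem_filter_lt (x + 1) (innerWord Φ w))
      rw [hfilter, hwT] at h2
      match hm : R.tableau (x + 1) ((innerWord Φ w).filter (· < x + 1)) with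
      | [] => rw [hm] at i2; simp at i2
      | m :: T' =>
        rw [hm] at h2 i1
        obtain rfl : T' = T := h2
        have := hsum w m hm
        exact ⟨⟨⟨m, (isTableau_cons.1 i1).1, by omega⟩, ⟨w, hw1, hm⟩⟩, rfl⟩

/-- Both decompositions are indexed by data of the shape alone, so the induction matches the pieces
for two different rules and two different tableaux of equal shape. When the profile is exhausted,
the only possible tableau is the empty one. -/
theorem nonempty_fiber_equiv (R R' : InsertionRule) {K : ℕ} (Φ : List (Option ℕ)) {h : ℕ}
    {T T' : List RowLengths} (hT : IsTableau T) (hT' : IsTableau T') (hl : T.length = h)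
    (hl' : T'.length = h) (htop : topShape T = topShape T') :
    Nonempty (R.Fiber K h Φ T ≃ R'.Fiber K h Φ T') := by
  induction Φ generalizing h T T' with
  | nil =>
    have key : ∀ (Q : InsertionRule) {S : List RowLengths}, S.length = h →
        IsTableau S → topShape S = 0 → Nonempty (Unique (Q.Fiber K h [] S)) := by
      intro Q S hS hS' h0
      have := hS'.eq_replicate h0
      rw [hS] at this
      refine ⟨⟨⟨⟨[], trivial, by simpa [innerWord, tableau] using this.symm⟩⟩, ?_⟩⟩
      rintro ⟨w, hw, hwT⟩
      match w with
      | [] => rfl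
      | x :: w => simp [HasProfile] at hw
    have key' : ∀ (Q : InsertionRule) {S : List RowLengths}, topShape S ≠ 0 →
        IsEmpty (Q.Fiber K h [] S) := by
      intro Q S h0
      refine ⟨?_⟩
      rintro ⟨w, hw, rfl⟩
      match w with
      | [] => exact h0 (topShape_replicate h)
      | x :: w => simp [HasProfile] at hw
    by_cases h0 : topShape T = 0
    · obtain ⟨u⟩ := key R hl hT h0
      obtain ⟨u'⟩ := key R' hl' hT' (htop ▸ h0)
      exact ⟨Equiv.ofUnique _ _⟩
    · have := key' R h0
      have := key' R' (htop ▸ h0)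
      exact ⟨Equiv.equivOfIsEmpty _ _⟩
  | cons o Φ ih =>
    cases o with
    | none =>
      by_cases hK : topShape T K = 0
      · obtain ⟨e⟩ := R.nonempty_fiber_none_equiv Φ hT hl rfl hK
        obtain ⟨e'⟩ := R'.nonempty_fiber_none_equiv Φ hT' hl' htop.symm hK
        have : ∀ b : {b : ℕ // (topShape T).Removable b}, Nonempty
            (R.Fiber K h Φ (R.extract T b).1 ≃ R'.Fiber K h Φ (R'.extract T' b).1) := by
          rintro ⟨b, hb⟩
          obtain ⟨i1, i2, i3, -⟩ := R.extract_spec hT hb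
          obtain ⟨j1, j2, j3, -⟩ := R'.extract_spec hT' (htop ▸ hb)
          exact ih i1 j1 (i2.trans hl) (j2.trans hl') (by rw [i3, j3, htop])
        exact ⟨e.symm.trans ((Equiv.sigmaCongrRight fun b => (this b).some).trans e')⟩
      · have key : ∀ (Q : InsertionRule) {S : List RowLengths}, topShape S K ≠ 0 →
            IsEmpty (Q.Fiber K h (none :: Φ) S) := by
          intro Q S h0
          refine ⟨?_⟩
          rintro ⟨w, hw, rfl⟩
          match w with
          | [] => simp [HasProfile] at hw
          | x :: w =>
            obtain ⟨-, hx, hw⟩ := hw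
            rw [innerWord, List.filter_cons_of_pos (by simpa using hx)] at h0
            exact h0 hw
        have := key R hK
        have := key R' (htop ▸ hK)
        exact ⟨Equiv.equivOfIsEmpty _ _⟩
    | some s =>
      obtain ⟨e⟩ := R.nonempty_fiber_some_equiv (K := K) s Φ hT hl rfl
      obtain ⟨e'⟩ := R'.nonempty_fiber_some_equiv (K := K) s Φ hT' hl' htop.symm
      have : ∀ m : {m : RowLengths // HStrip (topShape T) m ∧
          ∑ i ∈ Finset.range (h + 1), m i + 1 =
            ∑ i ∈ Finset.range (h + 1), topShape T i + s},
          Nonempty (R.Fiber K (h + 1) Φ (m.1 :: T) ≃ R'.Fiber K (h + 1) Φ (m.1 :: T')) := by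
        rintro ⟨m, hm, -⟩
        exact ih (isTableau_cons.2 ⟨hm, hT⟩) (isTableau_cons.2 ⟨htop ▸ hm, hT'⟩) (by simp [hl])
          (by simp [hl']) rfl
      exact ⟨e.symm.trans ((Equiv.sigmaCongrRight fun b => (this b).some).trans e')⟩

theorem nonempty_hasProfile_equiv (R R' : InsertionRule) (K : ℕ) (Φ : List (Option ℕ)) :
    Nonempty ({w // HasProfile (R.Short K) 0 Φ w} ≃ {w // HasProfile (R'.Short K) 0 Φ w}) := by
  have key : ∀ Q : InsertionRule, Nonempty
      ({w // HasProfile (Q.Short K) 0 Φ w} ≃ Q.Fiber K 0 Φ []) := fun Q =>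
    ⟨Equiv.subtypeEquivRight fun w => by simp [tableau]⟩
  obtain ⟨e⟩ := key R
  obtain ⟨e'⟩ := key R'
  obtain ⟨f⟩ := nonempty_fiber_equiv R R' (K := K) Φ (h := 0) (T := []) (T' := []) trivial trivial
    rfl rfl rfl
  exact ⟨e.trans (f.trans e'.symm)⟩

end InsertionRule

/-! ### Longest monotone subsequences -/

/-- The maximal length of a strictly increasing subsequence with letters at least `v`. -/
def increasingLength : List ℕ → ℕ → ℕ
  | [], _ => 0
  | x :: u, v =>
    if v ≤ x then max (increasingLength u v) (increasingLength u (x + 1) + 1)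
    else increasingLength u v

/-- The maximal length of a strictly decreasing subsequence with letters below `c`. -/
def decreasingLength : List ℕ → ℕ → ℕ
  | [], _ => 0
  | x :: u, c =>
    if x < c then max (decreasingLength u c) (decreasingLength u x + 1) else decreasingLength u c

theorem le_increasingLength_iff {u : List ℕ} {v k : ℕ} :
    k ≤ increasingLength u v ↔
      ∃ l : List ℕ, l.Sublist u ∧ l.Pairwise (· < ·) ∧ (∀ x ∈ l, v ≤ x) ∧ l.length = k := by
  induction u generalizing v k with
  | nil =>
    simp only [increasingLength, List.sublist_nil]
    constructor
    · intro h
      exact ⟨[], by simp; omega⟩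
    · rintro ⟨l, rfl, -, -, rfl⟩
      simp
  | cons y u ih =>
    constructor
    · intro h
      have key : k ≤ increasingLength u v ∨ v ≤ y ∧ k ≤ increasingLength u (y + 1) + 1 := by
        simp only [increasingLength] at h
        split_ifs at h with hv
        · simpa [hv] using h
        · exact Or.inl h
      rcases key with h | ⟨hv, h⟩
      · obtain ⟨l, h1, h2⟩ := ih.1 h
        exact ⟨l, h1.cons y, h2⟩
      · cases k with
        | zero => exact ⟨[], by simp⟩
        | succ k =>
          obtain ⟨l, h1, h2, h3, h4⟩ := ih.1 (Nat.le_of_succ_le_succ h)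
          refine ⟨y :: l, h1.cons_cons y, List.pairwise_cons.2 ⟨h3, h2⟩, ?_, by simp [h4]⟩
          intro x hx
          rcases List.mem_cons.1 hx with rfl | hx
          · exact hv
          · have := h3 x hx
            omega
    · rintro ⟨l, h1, h2, h3, rfl⟩
      have mono : increasingLength u v ≤ increasingLength (y :: u) v := by
        simp only [increasingLength]
        split_ifs
        · exact le_max_left _ _
        · exact le_rfl
      rcases List.sublist_cons_iff.1 h1 with h1' | ⟨l', rfl, h1'⟩
      · exact (ih.2 ⟨l, h1', h2, h3, rfl⟩).trans mono
      · rw [List.pairwise_cons] at h2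
        have : l'.length ≤ increasingLength u (y + 1) :=
          ih.2 ⟨l', h1', h2.2, fun x hx => h2.1 x hx, rfl⟩
        rw [increasingLength, if_pos (h3 y (by simp)), List.length_cons]
        exact (Nat.succ_le_succ this).trans (le_max_right _ _)

theorem le_decreasingLength_iff {u : List ℕ} {c k : ℕ} :
    k ≤ decreasingLength u c ↔
      ∃ l : List ℕ, l.Sublist u ∧ l.Pairwise (· > ·) ∧ (∀ x ∈ l, x < c) ∧ l.length = k := by
  induction u generalizing c k with
  | nil =>
    simp only [decreasingLength, List.sublist_nil]
    constructor
    · intro h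
      exact ⟨[], by simp; omega⟩
    · rintro ⟨l, rfl, -, -, rfl⟩
      simp
  | cons y u ih =>
    constructor
    · intro h
      have key : k ≤ decreasingLength u c ∨ y < c ∧ k ≤ decreasingLength u y + 1 := by
        simp only [decreasingLength] at h
        split_ifs at h with hv
        · simpa [hv] using h
        · exact Or.inl h
      rcases key with h | ⟨hv, h⟩
      · obtain ⟨l, h1, h2⟩ := ih.1 h
        exact ⟨l, h1.cons y, h2⟩
      · cases k with
        | zero => exact ⟨[], by simp⟩
        | succ k =>
          obtain ⟨l, h1, h2, h3, h4⟩ := ih.1 (Nat.le_of_succ_le_succ h)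
          refine ⟨y :: l, h1.cons_cons y, List.pairwise_cons.2 ⟨h3, h2⟩, ?_, by simp [h4]⟩
          intro x hx
          rcases List.mem_cons.1 hx with rfl | hx
          · exact hv
          · exact (h3 x hx).trans hv
    · rintro ⟨l, h1, h2, h3, rfl⟩
      have mono : decreasingLength u c ≤ decreasingLength (y :: u) c := by
        simp only [decreasingLength]
        split_ifs
        · exact le_max_left _ _
        · exact le_rfl
      rcases List.sublist_cons_iff.1 h1 with h1' | ⟨l', rfl, h1'⟩
      · exact (ih.2 ⟨l, h1', h2, h3, rfl⟩).trans mono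
      · rw [List.pairwise_cons] at h2
        have : l'.length ≤ decreasingLength u y :=
          ih.2 ⟨l', h1', h2.2, fun x hx => h2.1 x hx, rfl⟩
        rw [decreasingLength, if_pos (h3 y (by simp)), List.length_cons]
        exact (Nat.succ_le_succ this).trans (le_max_right _ _)

theorem decreasingLength_mono (u : List ℕ) : Monotone (decreasingLength u) := by
  intro c d hcd
  obtain ⟨l, h1, h2, h3, h4⟩ := le_decreasingLength_iff.1 (le_refl (decreasingLength u c))
  exact le_decreasingLength_iff.2 ⟨l, h1, h2, fun x hx => (h3 x hx).trans_le hcd, h4⟩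

theorem decreasingLength_filter (u : List ℕ) {c h : ℕ} (hc : c ≤ h) :
    decreasingLength (u.filter (· < h)) c = decreasingLength u c := by
  induction u generalizing c with
  | nil => rfl
  | cons x u ih =>
    by_cases hx : x < h
    · rw [List.filter_cons_of_pos (by simpa using hx)]
      simp only [decreasingLength, ih hc, ih hx.le]
    · rw [List.filter_cons_of_neg (by simpa using hx), ih hc, decreasingLength, if_neg (by omega)]

/-! ### Rows under column insertion and decreasing subsequences -/

namespace InsertionRule

open RowLengths

/-- The numbers of rows obey a local rule of their own: if `r` and `s` have `m` and `m'` rows and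
the grown `r` has `m₁`, the grown `s` has `max m' m₁`. For the largest letter `m₁` is set to `m +
1`. This is the recursion of `decreasingLength`. -/
theorem column_push_eq_zero_iff {N m m' m₁ : ℕ} {r s : RowLengths} {o : Option ℕ}
    (h : HStrip r s) (hm : ∀ j, r j = 0 ↔ m ≤ j) (hm' : ∀ j, s j = 0 ↔ m' ≤ j) (hN : m ≤ N)
    (hnone : o = none → m₁ = m + 1)
    (hsome : ∀ a, o = some a → ∀ j, r.addBox a j = 0 ↔ m₁ ≤ j) (j : ℕ) :
    s.addBox (column.push N r s o) j = 0 ↔ max m' m₁ ≤ j := by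
  classical
  have hb : column.push N r s o =
      Nat.findGreatest (fun b => ∀ i, i + 1 = b → s b < r i) (o.getD N) := by
    simp only [column]
  have hQ : ∀ i, i + 1 = column.push N r s o → s (column.push N r s o) < r i := by
    rw [hb]
    exact Nat.findGreatest_spec (P := fun b => ∀ i, i + 1 = b → s b < r i) (Nat.zero_le _)
      (by simp)
  have hle : column.push N r s o ≤ o.getD N := hb ▸ Nat.findGreatest_le _
  have hmax : ∀ j, column.push N r s o ≤ j → j + 1 ≤ o.getD N → r j ≤ s (j + 1) := by
    intro j hj hj'
    have := Nat.findGreatest_is_greatest (P := fun b => ∀ i, i + 1 = b → s b < r i)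
      (n := o.getD N) (k := j + 1) (by omega) hj'
    simpa using this
  generalize column.push N r s o = b at *
  have hmm : m ≤ m' := by
    have := (h m').1
    have := (hm' m').2 le_rfl
    exact (hm m').1 (by omega)
  have hmm' : m' ≤ m + 1 := by
    have := (h m).2
    have := (hm m).2 le_rfl
    exact (hm' (m + 1)).1 (by omega)
  have hbm : b ≤ m := by
    by_contra hbm
    obtain ⟨i, rfl⟩ : ∃ i, b = i + 1 := ⟨b - 1, by omega⟩
    have := hQ i rfl
    have := (hm i).2 (by omega)
    omega
  -- The search for `b` starts at row `o.getD N`; whether this is below the last row of `r` is what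
  -- `m₁` records.
  have ho : m₁ = m + 1 ∧ m ≤ o.getD N ∨ m₁ = m ∧ o.getD N < m := by
    cases o with
    | none => exact Or.inl ⟨hnone rfl, hN⟩
    | some a =>
      have h1 := hsome a rfl
      simp only [Option.getD_some]
      simp only [addBox] at h1
      by_cases ham : a < m
      · refine Or.inr ⟨?_, ham⟩
        have h2 : ∀ j, m₁ ≤ j ↔ m ≤ j := by
          intro j
          rw [← h1, ← hm]
          split_ifs with hj
          · subst hj
            have := hm j
            simp only [false_iff]
            omega
          · rfl
        have := h2 m
        have := h2 m₁
        omega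
      · have h2 : ∀ j, m₁ ≤ j ↔ m ≤ j ∧ j ≠ a := by
          intro j
          rw [← h1, ← hm]
          split_ifs with hj <;> simp [hj]
        have h3 := h2 m
        have h4 := h2 m₁
        have h5 := h2 (m + 1)
        have h6 := h2 a
        omega
  -- A new row of `s` is opened only if the strip has not yet reached row `m` and the search starts
  -- there or below.
  have key : b = m' ∧ m₁ = m' + 1 ∨ b < m' ∧ m₁ ≤ m' := by
    by_cases hc : m' = m ∧ m₁ = m + 1
    · refine Or.inl ⟨?_, by omega⟩
      by_contra hne
      obtain ⟨i, rfl⟩ : ∃ i, m = i + 1 := ⟨m - 1, by omega⟩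
      have h1 := hmax i (by omega) (by omega)
      have h2 := (hm' (i + 1)).2 (by omega)
      have h3 := (hm i).1 (by omega)
      omega
    · right
      omega
  have hj := hm' j
  simp only [addBox]
  split_ifs with hjb
  · simp only [false_iff]
    omega
  · omega

/-- The induction is on the alphabet and then on the word: the last shape of the chain is governed
by the letters below `h + 1`, the one before it by those below `h`. -/
theorem topShape_column_tableau_eq_zero_iff {h : ℕ} {u : List ℕ} (hu : ∀ x ∈ u, x < h) (j : ℕ) :
    topShape (column.tableau h u) j = 0 ↔ decreasingLength u h ≤ j := by
  induction h generalizing u j with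
  | zero =>
    have : u = [] := List.eq_nil_iff_forall_not_mem.2 fun x hx => by simpa using hu x hx
    subst this
    simp [tableau, decreasingLength]
  | succ h ihh =>
    induction u generalizing j with
    | nil => simp [tableau, decreasingLength, topShape_replicate]
    | cons x u ihu =>
      have hu' : ∀ y ∈ u, y < h + 1 := fun y hy => hu y (by simp [hy])
      have hx := hu x (by simp)
      have hm' := fun j => ihu hu' j
      obtain ⟨i1, i2⟩ := column.tableau_spec hu'
      have i3 := column.tail_tableau hu'
      have hfil : ∀ u : List ℕ, ∀ y ∈ u.filter (· < h), y < h := by simp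
      have hm : ∀ j, topShape (column.tableau h (u.filter (· < h))) j = 0 ↔
          decreasingLength u h ≤ j := by
        intro j
        rw [ihh (hfil u), decreasingLength_filter u le_rfl]
      have hm₁ := fun j => ihh (hfil (x :: u)) j
      match hT : column.tableau (h + 1) u with
      | [] => simp [hT] at i2
      | s :: T =>
        have hl : T.length = h := by simpa [hT] using i2
        rw [hT] at i1 i3 hm'
        rw [List.tail_cons] at i3
        rw [← i3] at hm
        obtain ⟨hs, hT'⟩ := isTableau_cons.1 i1
        have hN : decreasingLength u h ≤ T.length :=
          (hm _).1 (hT'.topShape_eq_zero le_rfl)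
        rw [tableau, hT]
        by_cases hxh : x = h
        · subst hxh
          simp only [insert, hl, if_true, topShape_cons]
          rw [decreasingLength, if_pos (Nat.lt_succ_self x)]
          exact column_push_eq_zero_iff (N := x) hs hm hm' (by omega) (fun _ => rfl) (by simp) j
        · have hxh' : x < h := by omega
          simp only [insert, hl, hxh, if_false, topShape_cons]
          have hmax : decreasingLength (x :: u) (h + 1) =
              max (decreasingLength u (h + 1)) (decreasingLength (x :: u) h) := by
            have := decreasingLength_mono u (Nat.le_succ h)
            simp only [decreasingLength, hx, hxh', if_true]
            simp only [Nat.succ_eq_add_one] at this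
            omega
          rw [hmax]
          refine column_push_eq_zero_iff hs hm hm' (by omega) (by simp) ?_ j
          intro a ha j
          cases ha
          rw [← (column.insert_spec hT' (x := x) (by omega)).2.2.1, ← decreasingLength_filter _ le_rfl,
            ← hm₁, List.filter_cons_of_pos (by simpa using hxh'), tableau, i3]

end InsertionRule

/-! ### Rows under row insertion and increasing subsequences -/

theorem increasingLength_antitone (u : List ℕ) : Antitone (increasingLength u) := by
  intro v w hvw
  obtain ⟨l, h1, h2, h3, h4⟩ := le_increasingLength_iff.1 (le_refl (increasingLength u w))
  exact le_increasingLength_iff.2 ⟨l, h1, h2, fun x hx => hvw.trans (h3 x hx), h4⟩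

theorem increasingLength_of_forall_le {u : List ℕ} {v : ℕ} (h : ∀ x ∈ u, v ≤ x) :
    increasingLength u v = increasingLength u 0 := by
  induction u with
  | nil => rfl
  | cons x u ih =>
    simp only [increasingLength, h x (by simp), ih fun y hy => h y (by simp [hy]), Nat.zero_le,
      if_true]

namespace InsertionRule

open RowLengths

/-- The letter bumped from the first row by the row insertion of `x`. -/
def bumped : List RowLengths → ℕ → Option ℕ
  | [], _ => none
  | s :: T, x =>
    if x = T.length then none
    else match bumped T x with
      | some y => some y
      | none => if s 0 = topShape T 0 then none else some T.length

/-- The letter `c` occurs in the first row of a tableau. -/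
def InFirstRow : List RowLengths → ℕ → Prop
  | [], _ => False
  | s :: T, c => c = T.length ∧ topShape T 0 < s 0 ∨ InFirstRow T c

theorem InFirstRow.lt_length {T : List RowLengths} {c : ℕ} (h : InFirstRow T c) :
    c < T.length := by
  induction T with
  | nil => exact h.elim
  | cons s T ih =>
    rcases h with ⟨rfl, -⟩ | h
    · simp
    · have := ih h
      simp only [List.length_cons]
      omega

/-- Remove the first row. -/
def dropFirstRow (T : List RowLengths) : List RowLengths := T.map fun s i => s (i + 1)

theorem topShape_dropFirstRow (T : List RowLengths) (i : ℕ) :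
    topShape (dropFirstRow T) i = topShape T (i + 1) := by
  cases T <;> rfl

/-- Below row `0` the local row rule is invariant under shifting the rows. The growth leaves row `0`
at the strip of the bumped letter, and there the shifted chain sees the largest letter of its
alphabet being inserted. -/
theorem row_insert_of_bumped (T : List RowLengths) {x : ℕ} (hx : x < T.length) :
    (bumped T x = none → (row.insert T x).2 = 0 ∧
      dropFirstRow (row.insert T x).1 = dropFirstRow T) ∧
    ∀ y, bumped T x = some y → y < T.length ∧
      (row.insert T x).2 = (row.insert (dropFirstRow T) y).2 + 1 ∧
      dropFirstRow (row.insert T x).1 = (row.insert (dropFirstRow T) y).1 := by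
  induction T with
  | nil => simp at hx
  | cons s T ih =>
    have add_zero : ∀ s : RowLengths, (fun i => s.addBox 0 (i + 1)) = fun i => s (i + 1) := by
      intro s
      funext i
      simp [addBox]
    have add_succ : ∀ (s : RowLengths) (b : ℕ), (fun i => s.addBox (b + 1) (i + 1)) =
        addBox (fun i => s (i + 1)) b := by
      intro s b
      funext i
      simp [addBox]
    have htop : topShape (dropFirstRow T) = fun i => topShape T (i + 1) := by
      funext i
      exact topShape_dropFirstRow T i
    have hlen : (dropFirstRow T).length = T.length := by simp [dropFirstRow]
    have hcons : ∀ (s : RowLengths) T, dropFirstRow (s :: T) =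
        (fun i => s (i + 1)) :: dropFirstRow T := fun s T => rfl
    by_cases hxT : x = T.length
    · subst hxT
      have hrow : row.push T.length (topShape T) s none = 0 := rfl
      simp only [bumped, if_true, insert, hrow]
      refine ⟨fun _ => ⟨trivial, ?_⟩, by simp⟩
      rw [hcons, hcons, add_zero]
    · obtain ⟨ih1, ih2⟩ := ih (by simp only [List.length_cons] at hx; omega)
      cases hb : bumped T x with
      | none =>
        obtain ⟨ih3, ih4⟩ := ih1 hb
        by_cases hs : s 0 = topShape T 0
        · have hrow : row.push T.length (topShape T) s (some 0) = 0 := by simp [row, rowPush, hs]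
          simp only [bumped, hxT, if_false, hb, hs, if_true, insert, ih3, hrow]
          refine ⟨fun _ => ⟨trivial, ?_⟩, by simp⟩
          rw [hcons, hcons, add_zero, ih4]
        · have hrow : row.push T.length (topShape T) s (some 0) = 1 := by simp [row, rowPush, hs]
          have hrow' : row.push (dropFirstRow T).length (topShape (dropFirstRow T))
            (fun i => s (i + 1)) none = 0 := rfl
          simp only [bumped, hxT, if_false, hb, hs, insert, ih3, hrow]
          refine ⟨by simp, ?_⟩
          rintro y ⟨⟩
          rw [hcons, hcons]
          simp only [insert, hlen, if_true]
          rw [← hlen, hrow', ih4]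
          exact ⟨by simp [hlen], rfl, by rw [← add_succ]⟩
      | some y =>
        obtain ⟨ih3, ih4, ih5⟩ := ih2 y hb
        have hrow : ∀ a, row.push T.length (topShape T) s (some (a + 1)) =
            row.push T.length (topShape (dropFirstRow T)) (fun i => s (i + 1)) (some a) + 1 := by
          intro a
          simp only [row, rowPush, htop]
          split_ifs <;> rfl
        simp only [bumped, hxT, if_false, hb, insert, ih4]
        refine ⟨by simp, ?_⟩
        rintro y ⟨⟩
        rw [hcons, hcons]
        simp only [insert, hlen, ih3.ne, if_false, hrow]
        exact ⟨by simp; omega, trivial, by rw [← add_succ, ih5]⟩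

/-- This is the usual bumping: `x` displaces the smallest larger letter `y` of the first row. The
row is tracked only as a set of letters, so it stays open whether another copy of `y` remains. -/
theorem inFirstRow_insert {T : List RowLengths} (hT : IsTableau T) {x : ℕ} (hx : x < T.length) :
    (bumped T x = none →
      (∀ c, InFirstRow (row.insert T x).1 c ↔ InFirstRow T c ∨ c = x) ∧
      ∀ c, InFirstRow T c → c ≤ x) ∧
    ∀ y, bumped T x = some y → InFirstRow T y ∧ x < y ∧
      (∀ c, InFirstRow T c → x < c → y ≤ c) ∧ InFirstRow (row.insert T x).1 x ∧
      (∀ c, InFirstRow (row.insert T x).1 c → InFirstRow T c ∨ c = x) ∧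
      ∀ c, c ≠ y → InFirstRow T c → InFirstRow (row.insert T x).1 c := by
  induction T with
  | nil => simp at hx
  | cons s T ih =>
    obtain ⟨hs, hT'⟩ := isTableau_cons.1 hT
    by_cases hxT : x = T.length
    · subst hxT
      have hrow : row.push T.length (topShape T) s none = 0 := rfl
      simp only [bumped, if_true, insert, hrow]
      refine ⟨fun _ => ⟨fun c => ?_, ?_⟩, by simp⟩
      · have := (hs 0).1
        have h1 : topShape T 0 < s.addBox 0 0 := by simp [addBox]; omega
        simp only [InFirstRow, h1, and_true]
        constructor
        · tauto
        · rintro ((⟨rfl, -⟩ | h) | h)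
          · exact Or.inl rfl
          · exact Or.inr h
          · exact Or.inl h
      · rintro c (⟨rfl, -⟩ | h)
        · exact le_rfl
        · exact h.lt_length.le
    · have hxT' : x < T.length := by simp only [List.length_cons] at hx; omega
      obtain ⟨i1, i2, i3, -⟩ := row.insert_spec hT' hxT'
      obtain ⟨ih1, ih2⟩ := ih hT' hxT'
      obtain ⟨r1, r2⟩ := row_insert_of_bumped T hxT'
      cases hb : bumped T x with
      | none =>
        obtain ⟨ih3, ih4⟩ := ih1 hb
        obtain ⟨r3, -⟩ := r1 hb
        rw [r3] at i3
        have h0 : topShape (row.insert T x).1 0 = topShape T 0 + 1 := by rw [i3]; simp [addBox]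
        by_cases hs0 : s 0 = topShape T 0
        · have hrow : row.push T.length (topShape T) s (some 0) = 0 := by simp [row, rowPush, hs0]
          simp only [bumped, hxT, if_false, hb, hs0, if_true, insert, r3, hrow]
          refine ⟨fun _ => ⟨fun c => ?_, ?_⟩, by simp⟩
          · simp [InFirstRow, h0, addBox, hs0, ih3]
          · rintro c (⟨-, h⟩ | h)
            · omega
            · exact ih4 c h
        · have hrow : row.push T.length (topShape T) s (some 0) = 1 := by simp [row, rowPush, hs0]
          simp only [bumped, hxT, if_false, hb, hs0, insert, r3, hrow]
          refine ⟨by simp, ?_⟩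
          rintro y ⟨⟩
          refine ⟨Or.inl ⟨rfl, ?_⟩, hxT', ?_, Or.inr ((ih3 x).2 (Or.inr rfl)), ?_, ?_⟩
          · have := (hs 0).1
            omega
          · rintro c (⟨rfl, -⟩ | h) hc
            · exact le_rfl
            · have := ih4 c h
              omega
          · rintro c (⟨rfl, h⟩ | h)
            · left
              left
              rw [h0, i2, addBox, if_neg (by simp)] at *
              exact ⟨rfl, by omega⟩
            · rcases (ih3 c).1 h with h | h
              · exact Or.inl (Or.inr h)
              · exact Or.inr h
          · rintro c hc (⟨rfl, -⟩ | h)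
            · exact absurd rfl hc
            · exact Or.inr ((ih3 c).2 (Or.inl h))
      | some y =>
        obtain ⟨j1, j2, j3, j4, j5, j6⟩ := ih2 y hb
        obtain ⟨-, r3, -⟩ := r2 y hb
        rw [r3] at i3
        have h0 : topShape (row.insert T x).1 0 = topShape T 0 := by rw [i3]; simp [addBox]
        have hrow : ∀ a, s.addBox (row.push T.length (topShape T) s (some (a + 1))) 0 = s 0 := by
          intro a
          simp only [row, rowPush, addBox]
          split_ifs <;> first | rfl | grind
        simp only [bumped, hxT, if_false, hb, insert, r3]
        refine ⟨by simp, ?_⟩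
        rintro y ⟨⟩
        simp only [InFirstRow, hrow, h0, i2]
        refine ⟨Or.inr j1, j2, ?_, Or.inr j4, ?_, ?_⟩
        · rintro c (⟨rfl, -⟩ | h) hc
          · exact j1.lt_length.le
          · exact j3 c h hc
        · rintro c (h | h)
          · exact Or.inl (Or.inl h)
          · rcases j5 c h with h | h
            · exact Or.inl (Or.inr h)
            · exact Or.inr h
        · rintro c hc (h | h)
          · exact Or.inl h
          · exact Or.inr (j6 c hc h)

/-- The word formed by the letters bumped from the first row during row insertion. -/
def bumpedWord (h : ℕ) : List ℕ → List ℕ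
  | [] => []
  | x :: u =>
    match bumped (row.tableau h u) x with
    | none => bumpedWord h u
    | some y => y :: bumpedWord h u

theorem dropFirstRow_tableau {h : ℕ} {u : List ℕ} (hu : ∀ x ∈ u, x < h) :
    (∀ x ∈ bumpedWord h u, x < h) ∧
      dropFirstRow (row.tableau h u) = row.tableau h (bumpedWord h u) := by
  induction u with
  | nil =>
    refine ⟨by simp [bumpedWord], ?_⟩
    simp only [dropFirstRow, tableau, bumpedWord, List.map_replicate]
    rfl
  | cons x u ih =>
    have hu' : ∀ y ∈ u, y < h := fun y hy => hu y (by simp [hy])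
    obtain ⟨ih1, ih2⟩ := ih hu'
    obtain ⟨i1, i2⟩ := row.tableau_spec hu'
    obtain ⟨r1, r2⟩ := row_insert_of_bumped (row.tableau h u) (x := x)
      (by rw [i2]; exact hu x (by simp))
    cases hb : bumped (row.tableau h u) x with
    | none =>
      simp only [bumpedWord, hb, tableau]
      exact ⟨ih1, by rw [(r1 hb).2, ih2]⟩
    | some y =>
      simp only [bumpedWord, hb, tableau]
      refine ⟨?_, by rw [(r2 y hb).2.2, ih2]⟩
      intro z hz
      rcases List.mem_cons.1 hz with rfl | hz
      · exact i2 ▸ (r2 _ hb).1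
      · exact ih1 z hz

/-- The increasing subsequences of `u` have the same lengths as those of the first row of its
tableau followed by the bumped word. -/
theorem increasingLength_bumpedWord {h : ℕ} {u : List ℕ} (hu : ∀ x ∈ u, x < h) :
    (∀ v, increasingLength (bumpedWord h u) v ≤ increasingLength u v) ∧
    (∀ v c, InFirstRow (row.tableau h u) c → v ≤ c →
      increasingLength (bumpedWord h u) (c + 1) + 1 ≤ increasingLength u v) ∧
    ∀ v, increasingLength u v ≤ increasingLength (bumpedWord h u) v ∨
      ∃ c, InFirstRow (row.tableau h u) c ∧ v ≤ c ∧
        increasingLength u v ≤ increasingLength (bumpedWord h u) (c + 1) + 1 := by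
  induction u with
  | nil =>
    refine ⟨fun v => le_rfl, ?_, fun v => Or.inl le_rfl⟩
    have : ∀ c, ¬ InFirstRow (List.replicate h 0) c := by
      intro c
      induction h with
      | zero => exact id
      | succ h ih =>
        rintro (⟨-, h⟩ | h)
        · simp at h
        · exact ih (by simp) h
    intro v c hc
    exact (this c hc).elim
  | cons x u ih =>
    have hu' : ∀ y ∈ u, y < h := fun y hy => hu y (by simp [hy])
    obtain ⟨a1, a2, a3⟩ := ih hu'
    obtain ⟨i1, i2⟩ := row.tableau_spec hu'
    obtain ⟨r1, r2⟩ := inFirstRow_insert i1 (x := x) (by rw [i2]; exact hu x (by simp))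
    have hE : ∀ v, increasingLength (x :: u) v = if v ≤ x then
      max (increasingLength u v) (increasingLength u (x + 1) + 1) else increasingLength u v :=
        fun v => rfl
    have hDE : ∀ v, increasingLength u v ≤ increasingLength (x :: u) v := by
      intro v
      rw [hE]
      split_ifs
      · exact le_max_left _ _
      · exact le_rfl
    have hxE : ∀ v, v ≤ x → increasingLength u (x + 1) + 1 ≤ increasingLength (x :: u) v := by
      intro v hv
      rw [hE, if_pos hv]
      exact le_max_right _ _
    have hcases : ∀ v, increasingLength (x :: u) v = increasingLength u v ∨
        v ≤ x ∧ increasingLength (x :: u) v = increasingLength u (x + 1) + 1 := by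
      intro v
      rw [hE]
      split_ifs with hv
      · rcases max_choice (increasingLength u v) (increasingLength u (x + 1) + 1) with h | h
        · exact Or.inl h
        · exact Or.inr ⟨hv, h⟩
      · exact Or.inl rfl
    cases hb : bumped (row.tableau h u) x with
    | none =>
      obtain ⟨r3, r4⟩ := r1 hb
      simp only [bumpedWord, hb, tableau]
      generalize increasingLength (x :: u) = E at *
      generalize increasingLength u = D at *
      generalize increasingLength (bumpedWord h u) = D' at *
      refine ⟨fun v => (a1 v).trans (hDE v), ?_, fun v => ?_⟩
      · intro v c hc hv
        rcases (r3 c).1 hc with hc | rfl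
        · exact (a2 v c hc hv).trans (hDE v)
        · exact (Nat.succ_le_succ (a1 _)).trans (hxE v hv)
      · rcases hcases v with h | ⟨hv, h⟩
        · rw [h]
          rcases a3 v with h | ⟨c, hc, h⟩
          · exact Or.inl h
          · exact Or.inr ⟨c, (r3 c).2 (Or.inl hc), h⟩
        -- Nothing was bumped, so no letter of the first row exceeds `x` and only the first
        -- alternative can occur.
        · rcases a3 (x + 1) with h' | ⟨c, hc, hxc, -⟩
          · exact Or.inr ⟨x, (r3 x).2 (Or.inr rfl), hv, by omega⟩
          · have := r4 c hc
            omega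
    | some y =>
      obtain ⟨r3, r4, r5, r6, r7, r8⟩ := r2 y hb
      have hE' : ∀ v, increasingLength (y :: bumpedWord h u) v = if v ≤ y then
        max (increasingLength (bumpedWord h u) v) (increasingLength (bumpedWord h u) (y + 1) + 1)
        else increasingLength (bumpedWord h u) v := fun v => rfl
      have anti := increasingLength_antitone (bumpedWord h u)
      simp only [bumpedWord, hb, tableau]
      generalize increasingLength (y :: bumpedWord h u) = E' at *
      generalize increasingLength (x :: u) = E at *
      generalize increasingLength u = D at *
      generalize increasingLength (bumpedWord h u) = D' at *
      have hDE' : ∀ v, D' v ≤ E' v := by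
        intro v
        rw [hE']
        split_ifs
        · exact le_max_left _ _
        · exact le_rfl
      have hyE' : ∀ v, v ≤ y → D' (y + 1) + 1 ≤ E' v := by
        intro v hv
        rw [hE', if_pos hv]
        exact le_max_right _ _
      refine ⟨fun v => ?_, ?_, fun v => ?_⟩
      · have h1 := hDE v
        have h2 := a1 v
        rw [hE']
        split_ifs with hv
        · have := a2 v y r3 hv
          omega
        · omega
      · intro v c hc hv
        have h1 := hDE v
        rw [hE']
        split_ifs with hcy
        · have hcx : c ≤ x := by
            rcases r7 c hc with h | h
            · by_contra hcx
              have := r5 c h (by omega)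
              omega
            · exact h.le
          -- A subsequence of the new bumped word may use `y`. Since `y` was in the first row, `D'
          -- (y + 1) + 1 ≤ D (x + 1)`, and putting `x` in front gains one more letter.
          have h2 := hxE v (by omega)
          have h3 := a2 (x + 1) y r3 r4
          rcases r7 c hc with h | rfl
          · have := a2 v c h hv
            omega
          · have := a1 (c + 1)
            omega
        · rcases r7 c hc with h | h
          · have := a2 v c h hv
            omega
          · omega
      · rcases hcases v with h | ⟨hv, h⟩
        · rw [h]
          rcases a3 v with h | ⟨c, hc, hvc, h⟩
          · exact Or.inl (h.trans (hDE' v))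
          · by_cases hcy : c = y
            · subst hcy
              exact Or.inl (h.trans (hyE' v hvc))
            · have := hDE' (c + 1)
              exact Or.inr ⟨c, r8 c hcy hc, hvc, by omega⟩
        · refine Or.inr ⟨x, r6, hv, ?_⟩
          rcases a3 (x + 1) with h' | ⟨c, hc, hxc, h'⟩
          · have := hDE' (x + 1)
            omega
          -- The first-row letter `c > x` is at least `y`, so the newly bumped `y` can take its
          -- place, and `x` becomes the letter from the first row.
          · have h1 := r5 c hc hxc
            have h2 := anti (show y + 1 ≤ c + 1 by omega)
            have h3 := hyE' (x + 1) r4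
            omega

/-- Every bumped letter is displaced by a smaller one. If the old witness exceeds `x`, then `x`
replaces it; otherwise it is smaller than the bumped letter and stays in the row. -/
theorem exists_inFirstRow_lt_bumpedWord {h : ℕ} {u : List ℕ} (hu : ∀ x ∈ u, x < h)
    (hne : u ≠ []) :
    ∃ c, InFirstRow (row.tableau h u) c ∧ ∀ y ∈ bumpedWord h u, c < y := by
  induction u with
  | nil => exact absurd rfl hne
  | cons x u ih =>
    have hu' : ∀ y ∈ u, y < h := fun y hy => hu y (by simp [hy])
    obtain ⟨i1, i2⟩ := row.tableau_spec hu'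
    obtain ⟨r1, r2⟩ := inFirstRow_insert i1 (x := x) (by rw [i2]; exact hu x (by simp))
    have ih : u = [] ∨ ∃ c, InFirstRow (row.tableau h u) c ∧ ∀ y ∈ bumpedWord h u, c < y := by
      by_cases h0 : u = []
      · exact Or.inl h0
      · exact Or.inr (ih hu' h0)
    cases hb : bumped (row.tableau h u) x with
    | none =>
      obtain ⟨r3, r4⟩ := r1 hb
      simp only [bumpedWord, hb, tableau]
      rcases ih with rfl | ⟨c, hc, hc'⟩
      · exact ⟨x, (r3 x).2 (Or.inr rfl), by simp [bumpedWord]⟩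
      · exact ⟨c, (r3 c).2 (Or.inl hc), hc'⟩
    | some y =>
      obtain ⟨r3, r4, r5, r6, r7, r8⟩ := r2 y hb
      simp only [bumpedWord, hb, tableau, List.mem_cons, forall_eq_or_imp]
      rcases ih with rfl | ⟨c, hc, hc'⟩
      · exact ⟨x, r6, r4, by simp [bumpedWord]⟩
      · by_cases hcx : c ≤ x
        · exact ⟨c, r8 c (by omega) hc, by omega, hc'⟩
        · exact ⟨x, r6, r4, fun y hy => by have := hc' y hy; omega⟩

/-- A first-row letter below all bumped letters can precede any increasing subsequence of the bumped
word, and no such subsequence is extended by more than one letter of the first row. -/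
theorem increasingLength_eq_succ {h : ℕ} {u : List ℕ} (hu : ∀ x ∈ u, x < h) (hne : u ≠ []) :
    increasingLength u 0 = increasingLength (bumpedWord h u) 0 + 1 := by
  obtain ⟨a1, a2, a3⟩ := increasingLength_bumpedWord hu
  obtain ⟨c, hc, hc'⟩ := exists_inFirstRow_lt_bumpedWord hu hne
  have h1 := a2 0 c hc (Nat.zero_le c)
  rw [increasingLength_of_forall_le fun y hy => hc' y hy] at h1
  refine le_antisymm ?_ h1
  rcases a3 0 with h2 | ⟨d, -, -, h2⟩
  · omega
  · have := increasingLength_antitone (bumpedWord h u) (Nat.zero_le (d + 1))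
    omega

/-- Deleting the first row of the tableau of a nonempty word leaves the tableau of the bumped word,
whose longest increasing subsequence is shorter by one. -/
theorem topShape_row_tableau_eq_zero_iff {h : ℕ} {u : List ℕ} (hu : ∀ x ∈ u, x < h) (j : ℕ) :
    topShape (row.tableau h u) j = 0 ↔ increasingLength u 0 ≤ j := by
  by_cases hne : u = []
  · subst hne
    simp [tableau, topShape_replicate, increasingLength]
  have h1 := increasingLength_eq_succ hu hne
  induction j generalizing u with
  | zero =>
    rw [h1]
    simp only [nonpos_iff_eq_zero, Nat.succ_ne_zero, iff_false]
    intro h0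
    have h2 := row.sum_topShape_tableau hu
    rw [Finset.sum_eq_zero] at h2
    · exact hne (List.length_eq_zero_iff.1 h2.symm)
    · intro i _
      -- An empty first row would make the whole shape empty, although its size is the length of the
      -- word.
      have := (row.tableau_spec hu).1.topShape_antitone (Nat.zero_le i)
      omega
  | succ j ih =>
    obtain ⟨b1, b2⟩ := dropFirstRow_tableau hu
    rw [← topShape_dropFirstRow, b2, h1, Nat.add_le_add_iff_right]
    by_cases hne' : bumpedWord h u = []
    · rw [hne']
      simp [tableau, topShape_replicate, increasingLength]
    · exact ih b1 hne' (increasingLength_eq_succ b1 hne')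

end InsertionRule

/-! ### Profiles and inner words in terms of positions -/

theorem innerWord_ofFn {n : ℕ} (φ : Fin n → Option ℕ) (a : Fin n → ℕ) :
    innerWord (List.ofFn φ) (List.ofFn a) =
      ((List.finRange n).filter fun j => φ j = none).map a := by
  induction n with
  | zero => rfl
  | succ n ih =>
    rw [List.ofFn_succ, List.ofFn_succ, List.finRange_succ, List.filter_cons]
    cases h : φ 0 with
    | none => simp [innerWord, ih, List.filter_map, Function.comp_def]
    | some s => simp [innerWord, ih, List.filter_map, Function.comp_def]

theorem count_innerWord_ofFn {n : ℕ} (φ : Fin n → Option ℕ) (a : Fin n → ℕ) (x : ℕ) :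
    (innerWord (List.ofFn φ) (List.ofFn a)).count x =
      (Finset.univ.filter fun j => φ j = none ∧ a j = x).card := by
  induction n with
  | zero => rfl
  | succ n ih =>
    rw [List.ofFn_succ, List.ofFn_succ, Fin.card_filter_univ_succ]
    cases h : φ 0 with
    | none =>
      simp only [innerWord, List.count_cons, ih, beq_iff_eq, true_and]
      split_ifs <;> rfl
    | some s => simp [innerWord, ih]

/-- The number of blocks opened before position `i`. -/
def openedBefore {n : ℕ} (φ : Fin n → Option ℕ) (i : Fin n) : ℕ :=
  (Finset.univ.filter fun j => j < i ∧ φ j ≠ none).card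

/-- The letters below `c` at the positions from `i` on where no block is opened. -/
def innerWordFrom {n : ℕ} (φ : Fin n → Option ℕ) (a : Fin n → ℕ) (c : ℕ) (i : Fin n) : List ℕ :=
  ((List.finRange n).filter fun j => i ≤ j ∧ φ j = none ∧ a j < c).map a

theorem openedBefore_zero {n : ℕ} (φ : Fin (n + 1) → Option ℕ) : openedBefore φ 0 = 0 := by
  simp [openedBefore]

theorem openedBefore_succ {n : ℕ} (φ : Fin (n + 1) → Option ℕ) (i : Fin n) :
    openedBefore φ i.succ = (if φ 0 ≠ none then 1 else 0) + openedBefore (fun j => φ j.succ) i := by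
  simp only [openedBefore, Fin.card_filter_univ_succ, Fin.succ_pos, true_and, Fin.succ_lt_succ_iff]
  split_ifs
  · rw [add_comm]
  · simp

theorem innerWordFrom_succ {n : ℕ} (φ : Fin (n + 1) → Option ℕ) (a : Fin (n + 1) → ℕ) (c : ℕ)
    (i : Fin n) :
    innerWordFrom φ a c i.succ = innerWordFrom (fun j => φ j.succ) (fun j => a j.succ) c i := by
  simp [innerWordFrom, List.finRange_succ, List.filter_map, Function.comp_def]

theorem innerWordFrom_zero {n : ℕ} (φ : Fin (n + 1) → Option ℕ) (a : Fin (n + 1) → ℕ) (c : ℕ)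
    (h0 : φ 0 = none) (ha : a 0 < c) :
    innerWordFrom φ a c 0 = a 0 ::
      (innerWord (List.ofFn fun j => φ j.succ) (List.ofFn fun j => a j.succ)).filter (· < c) := by
  simp [innerWordFrom, List.finRange_succ, List.filter_map, Function.comp_def, h0,
    ha, innerWord_ofFn, List.filter_filter, and_comm]

/-- The offset `h` counts the blocks opened before the word begins; it lets the induction pass a
block minimum. -/
theorem hasProfile_ofFn_iff {ok : ℕ → List ℕ → Prop} {n : ℕ} (φ : Fin n → Option ℕ)
    (a : Fin n → ℕ) (h : ℕ) :
    HasProfile ok h (List.ofFn φ) (List.ofFn a) ↔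
      ∀ i, (φ i = none → a i < h + openedBefore φ i ∧
          ok (h + openedBefore φ i) (innerWordFrom φ a (h + openedBefore φ i) i)) ∧
        ∀ s, φ i = some s → a i = h + openedBefore φ i ∧
          (Finset.univ.filter fun j => i < j ∧ φ j = none ∧ a j = h + openedBefore φ i).card + 1
            = s := by
  induction n generalizing h with
  | zero => simp [HasProfile]
  | succ n ih =>
    rw [Fin.forall_fin_succ, List.ofFn_succ, List.ofFn_succ]
    have hcard : ∀ (i : Fin n) (x : ℕ),
        (Finset.univ.filter fun j => i.succ < j ∧ φ j = none ∧ a j = x).card =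
          (Finset.univ.filter fun j : Fin n => i < j ∧ φ j.succ = none ∧ a j.succ = x).card := by
      intro i x
      rw [Fin.card_filter_univ_succ]
      simp
    have hcard0 : ∀ x : ℕ,
        (Finset.univ.filter fun j => 0 < j ∧ φ j = none ∧ a j = x).card =
          (innerWord (List.ofFn fun j => φ j.succ) (List.ofFn fun j => a j.succ)).count x := by
      intro x
      rw [Fin.card_filter_univ_succ, count_innerWord_ofFn]
      simp
    simp only [openedBefore_succ, openedBefore_zero, innerWordFrom_succ, hcard, hcard0, add_zero]
    cases h0 : φ 0 with
    | none =>
      simp only [HasProfile, ih, ne_eq, not_true_eq_false, if_false, zero_add, forall_true_left,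
        reduceCtorEq, false_implies, implies_true, and_true]
      rw [and_comm, and_congr_left_iff]
      intro _
      constructor
      · rintro ⟨h1, h2⟩
        exact ⟨h1, by rwa [innerWordFrom_zero φ a h h0 h1]⟩
      · rintro ⟨h1, h2⟩
        exact ⟨h1, by rwa [innerWordFrom_zero φ a h h0 h1] at h2⟩
    | some s =>
      simp only [HasProfile, ih, ne_eq, reduceCtorEq, not_false_eq_true, if_true, ← add_assoc,
        false_implies, true_and, Option.some.injEq, forall_eq']
      rw [and_comm]

theorem HasProfile.length_eq {ok : ℕ → List ℕ → Prop} {h : ℕ} {Φ : List (Option ℕ)} {w : List ℕ}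
    (hw : HasProfile ok h Φ w) : w.length = Φ.length := by
  induction Φ generalizing h w with
  | nil =>
    match w, hw with
    | [], _ => rfl
  | cons o Φ ih =>
    match o, w, hw with
    | none, x :: w, hw => simp [ih hw.1]
    | some s, x :: w, hw => simp [ih hw.1]

/-- Increasing or decreasing sublists of an inner word correspond to such sequences of
positions. -/
theorem exists_sublist_innerWordFrom_iff {n k : ℕ} (φ : Fin n → Option ℕ) (a : Fin n → ℕ) (c : ℕ)
    (i : Fin n) (r : ℕ → ℕ → Prop) :
    (∃ l : List ℕ, l.Sublist (innerWordFrom φ a c i) ∧ l.Pairwise r ∧ l.length = k) ↔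
      ∃ g : Fin k → Fin n, StrictMono g ∧ (∀ p, i ≤ g p ∧ φ (g p) = none ∧ a (g p) < c) ∧
        ∀ p q, p < q → r (a (g p)) (a (g q)) := by
  constructor
  · rintro ⟨l, hl, hr, rfl⟩
    rw [innerWordFrom, List.sublist_map_iff] at hl
    obtain ⟨l, hl, rfl⟩ := hl
    have hmem := hl.subset
    have hsort : l.Pairwise (· < ·) :=
      (List.pairwise_lt_finRange n).sublist (hl.trans List.filter_sublist)
    rw [List.pairwise_map, List.pairwise_iff_get] at hr
    rw [List.pairwise_iff_get] at hsort
    refine ⟨fun p => l.get (p.cast (by simp)), fun p q hpq => hsort _ _ hpq, fun p => ?_,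
      fun p q hpq => hr _ _ hpq⟩
    have := hmem (List.get_mem l (p.cast (by simp)))
    simpa using (List.mem_filter.1 this).2
  · rintro ⟨g, hg, hP, hr⟩
    refine ⟨(List.ofFn g).map a, ?_, ?_, by simp⟩
    · rw [innerWordFrom]
      refine List.Sublist.map a ?_
      have h1 : (List.ofFn g).Pairwise (· < ·) := List.pairwise_ofFn.2 fun p q hpq => hg hpq
      have h2 : ((List.finRange n).filter fun j => i ≤ j ∧ φ j = none ∧ a j < c).Pairwise
          (· < ·) := (List.pairwise_lt_finRange n).sublist List.filter_sublist
      refine List.sublist_of_subperm_of_pairwise (List.subperm_of_subset h1.nodup ?_) h1 h2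
      intro x hx
      obtain ⟨p, rfl⟩ := (List.mem_ofFn' _ _).1 hx
      simpa using hP p
    · rw [List.pairwise_map]
      exact List.pairwise_ofFn.2 fun p q hpq => hr p q hpq

/-! ### Partitions as words of block numbers -/

namespace SetPartition

variable {n : ℕ}

theorem mem_part_self (π : SetPartition n) (i : Fin n) : i ∈ π.part i :=
  π.mem_part (Finset.mem_univ i)

/-- The smallest element of the block of `i`. -/
def blockMin (π : SetPartition n) (i : Fin n) : Fin n := (π.part i).min' ⟨i, π.mem_part_self i⟩

theorem coe_blockMin (π : SetPartition n) (i : Fin n) : (π.blockMin i : WithTop (Fin n)) =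
    (π.part i).min := Finset.coe_min' _

theorem blockMin_le (π : SetPartition n) (i : Fin n) : π.blockMin i ≤ i :=
  Finset.min'_le _ _ (π.mem_part_self i)

theorem part_eq_of_mem_part {π : SetPartition n} {i j : Fin n} (h : j ∈ π.part i) :
    π.part j = π.part i :=
  π.part_eq_of_mem (π.part_mem.2 (Finset.mem_univ i)) h

theorem part_blockMin (π : SetPartition n) (i : Fin n) : π.part (π.blockMin i) = π.part i :=
  part_eq_of_mem_part (Finset.min'_mem _ _)

theorem blockMin_eq_iff {π : SetPartition n} {i j : Fin n} :
    π.blockMin i = π.blockMin j ↔ π.part i = π.part j := by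
  constructor
  · intro h
    rw [← part_blockMin, h, part_blockMin]
  · intro h
    simp only [blockMin, h]

theorem blockMin_blockMin (π : SetPartition n) (i : Fin n) :
    π.blockMin (π.blockMin i) = π.blockMin i :=
  blockMin_eq_iff.2 (π.part_blockMin i)

theorem mem_part_iff {π : SetPartition n} {i j : Fin n} :
    j ∈ π.part i ↔ π.blockMin j = π.blockMin i := by
  rw [blockMin_eq_iff]
  exact ⟨part_eq_of_mem_part, fun h => h ▸ π.mem_part_self j⟩

theorem canonicalSeq_lt_iff {π : SetPartition n} {i j : Fin n} :
    π.canonicalSeq i < π.canonicalSeq j ↔ π.blockMin i < π.blockMin j := by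
  have mono : ∀ i j, π.blockMin i ≤ π.blockMin j → π.canonicalSeq i ≤ π.canonicalSeq j := by
    intro i j h
    refine Finset.card_le_card fun B hB => ?_
    rw [Finset.mem_filter, ← coe_blockMin] at *
    exact ⟨hB.1, hB.2.trans (WithTop.coe_le_coe.2 h)⟩
  constructor
  · intro h
    by_contra h'
    exact absurd h (not_lt.2 (mono j i (not_lt.1 h')))
  · intro h
    refine Finset.card_lt_card ⟨fun B hB => ?_, fun hsub => ?_⟩
    · rw [Finset.mem_filter, ← coe_blockMin] at *
      exact ⟨hB.1, hB.2.trans (WithTop.coe_le_coe.2 h.le)⟩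
    · have := hsub (Finset.mem_filter.2 ⟨π.part_mem.2 (Finset.mem_univ j), le_rfl⟩)
      rw [Finset.mem_filter, ← coe_blockMin, ← coe_blockMin, WithTop.coe_le_coe] at this
      exact absurd h (not_lt.2 this.2)

/-- The number of the block of `i`, counted from `0` by increasing smallest elements. -/
def letter (π : SetPartition n) (i : Fin n) : ℕ :=
  (Finset.univ.filter fun j => j < π.blockMin i ∧ π.blockMin j = j).card

theorem letter_lt_iff {π : SetPartition n} {i j : Fin n} :
    π.letter i < π.letter j ↔ π.blockMin i < π.blockMin j := by
  constructor
  · intro h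
    by_contra h'
    refine absurd h (not_lt.2 (Finset.card_le_card fun x hx => ?_))
    simp only [Finset.mem_filter, Finset.mem_univ, true_and] at *
    exact ⟨hx.1.trans_le (not_lt.1 h'), hx.2⟩
  · intro h
    refine Finset.card_lt_card ⟨fun x hx => ?_, fun hsub => ?_⟩
    · simp only [Finset.mem_filter, Finset.mem_univ, true_and] at *
      exact ⟨hx.1.trans h, hx.2⟩
    · have : π.blockMin i ∈ Finset.univ.filter
          fun x => x < π.blockMin j ∧ π.blockMin x = x :=
        Finset.mem_filter.2 ⟨Finset.mem_univ _, h, π.blockMin_blockMin i⟩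
      simpa using hsub this

theorem letter_eq_iff {π : SetPartition n} {i j : Fin n} :
    π.letter i = π.letter j ↔ π.blockMin i = π.blockMin j := by
  have h1 := letter_lt_iff (π := π) (i := i) (j := j)
  have h2 := letter_lt_iff (π := π) (i := j) (j := i)
  rw [le_antisymm_iff, le_antisymm_iff, ← not_lt, ← not_lt, ← not_lt, ← not_lt, h1, h2]

theorem letter_injective : Function.Injective (letter : SetPartition n → Fin n → ℕ) := by
  intro π π' h
  have hpart : ∀ i, π.part i = π'.part i := by
    intro i
    ext j
    rw [mem_part_iff, mem_part_iff, ← letter_eq_iff, ← letter_eq_iff, h]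
  ext B
  have key : ∀ π π' : SetPartition n, (∀ i, π.part i = π'.part i) → B ∈ π.parts → B ∈ π'.parts := by
    intro π π' h hB
    obtain ⟨i, hi⟩ := π.nonempty_of_mem_parts hB
    rw [← π.part_eq_of_mem hB hi, h]
    exact π'.part_mem.2 (Finset.mem_univ i)
  exact ⟨key π π' hpart, key π' π fun i => (hpart i).symm⟩

/-- The profile of a partition records the size of each block at its smallest element. -/
def profile (π : SetPartition n) (i : Fin n) : Option ℕ :=
  if π.blockMin i = i then some (π.part i).card else none

theorem profile_eq_none_iff {π : SetPartition n} {i : Fin n} :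
    π.profile i = none ↔ π.blockMin i < i := by
  have := π.blockMin_le i
  rw [lt_iff_le_and_ne]
  simp [profile, this]

theorem profile_ne_none_iff {π : SetPartition n} {i : Fin n} :
    π.profile i ≠ none ↔ π.blockMin i = i := by
  simp [profile]

theorem openedBefore_profile (π : SetPartition n) (i : Fin n) :
    openedBefore π.profile i =
      (Finset.univ.filter fun j => j < i ∧ π.blockMin j = j).card := by
  simp only [openedBefore, profile_ne_none_iff]

theorem letter_lt_openedBefore_iff {π : SetPartition n} {i j : Fin n} :
    π.letter j < openedBefore π.profile i ↔ π.blockMin j < i := by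
  rw [openedBefore_profile]
  constructor
  · intro h
    by_contra h'
    refine absurd h (not_lt.2 (Finset.card_le_card fun x hx => ?_))
    simp only [Finset.mem_filter, Finset.mem_univ, true_and] at *
    exact ⟨hx.1.trans_le (not_lt.1 h'), hx.2⟩
  · intro h
    refine Finset.card_lt_card ⟨fun x hx => ?_, fun hsub => ?_⟩
    · simp only [Finset.mem_filter, Finset.mem_univ, true_and] at *
      exact ⟨hx.1.trans h, hx.2⟩
    · have : π.blockMin j ∈ Finset.univ.filter fun x => x < i ∧ π.blockMin x = x :=
        Finset.mem_filter.2 ⟨Finset.mem_univ _, h, π.blockMin_blockMin j⟩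
      simpa using hsub this

theorem letter_of_blockMin_eq {π : SetPartition n} {i : Fin n} (h : π.blockMin i = i) :
    π.letter i = openedBefore π.profile i := by
  rw [openedBefore_profile, letter, h]

/-- `a` numbers the blocks of a partition with profile `φ`. -/
def IsLetterOf (φ : Fin n → Option ℕ) (a : Fin n → ℕ) : Prop :=
  ∀ i, (φ i = none → a i < openedBefore φ i) ∧
    ∀ s, φ i = some s → a i = openedBefore φ i ∧
      (Finset.univ.filter fun j => i < j ∧ φ j = none ∧ a j = openedBefore φ i).card + 1 = s

theorem isLetterOf_letter (π : SetPartition n) : IsLetterOf π.profile π.letter := by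
  intro i
  refine ⟨fun h => letter_lt_openedBefore_iff.2 (profile_eq_none_iff.1 h), fun s hs => ?_⟩
  have hi : π.blockMin i = i := profile_ne_none_iff.1 (by simp [hs])
  refine ⟨letter_of_blockMin_eq hi, ?_⟩
  simp only [profile, hi, if_true, Option.some.injEq] at hs
  rw [← hs, ← Finset.card_erase_add_one (π.mem_part_self i)]
  congr 2
  ext j
  rw [Finset.mem_filter, Finset.mem_erase, mem_part_iff, profile_eq_none_iff,
    ← letter_of_blockMin_eq hi, letter_eq_iff, hi]
  simp only [Finset.mem_univ, true_and]
  constructor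
  · rintro ⟨h1, -, h2⟩
    exact ⟨h1.ne', h2⟩
  · rintro ⟨h1, h2⟩
    have := π.blockMin_le j
    rw [h2] at this ⊢
    exact ⟨lt_of_le_of_ne this (Ne.symm h1), lt_of_le_of_ne this (Ne.symm h1), rfl⟩

/-- The blocks are the level sets of `a`. Each letter first occurs at a position where `φ` opens a
block, and these new letters increase from left to right, so the numbering by minima gives back `a`.
-/
theorem exists_letter_eq {φ : Fin n → Option ℕ} {a : Fin n → ℕ} (h : IsLetterOf φ a) :
    ∃ π : SetPartition n, π.profile = φ ∧ π.letter = a := by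
  classical
  have mono : ∀ i j, i < j → openedBefore φ i ≤ openedBefore φ j := by
    intro i j hij
    refine Finset.card_le_card fun x hx => ?_
    simp only [Finset.mem_filter, Finset.mem_univ, true_and] at *
    exact ⟨hx.1.trans hij, hx.2⟩
  have smono : ∀ i j, i < j → φ i ≠ none → openedBefore φ i < openedBefore φ j := by
    intro i j hij hi
    refine Finset.card_lt_card ⟨fun x hx => ?_, fun hsub => ?_⟩
    · simp only [Finset.mem_filter, Finset.mem_univ, true_and] at *
      exact ⟨hx.1.trans hij, hx.2⟩
    · have := hsub (Finset.mem_filter.2 ⟨Finset.mem_univ i, hij, hi⟩)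
      simp at this
  have hsome : ∀ i, φ i ≠ none → a i = openedBefore φ i := by
    intro i hi
    obtain ⟨s, hs⟩ := Option.ne_none_iff_exists'.1 hi
    exact ((h i).2 s hs).1
  have hle : ∀ i, a i ≤ openedBefore φ i := by
    intro i
    by_cases hi : φ i = none
    · exact ((h i).1 hi).le
    · exact (hsome i hi).le
  have hlt : ∀ i j, φ i ≠ none → j < i → a j < a i := by
    intro i j hi hj
    rw [hsome i hi]
    by_cases hj' : φ j = none
    · exact ((h j).1 hj').trans_le (mono j i hj)
    · exact (hle j).trans_lt (smono j i hj hj')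
  have hex : ∀ m (i : Fin n), m < openedBefore φ i → ∃ j < i, φ j ≠ none ∧ a j = m := by
    intro m
    have hex' : ∀ N (i : Fin n), (i : ℕ) = N → m < openedBefore φ i →
        ∃ j < i, φ j ≠ none ∧ a j = m := by
      intro N
      induction N using Nat.strong_induction_on with
      | _ N ih =>
        intro i hN hm
        have hne : (Finset.univ.filter fun j => j < i ∧ φ j ≠ none).Nonempty :=
          Finset.card_pos.1 (Nat.zero_lt_of_lt hm)
        -- The last opening position `j` before `i` has the largest letter below `openedBefore φ i`;
        -- smaller letters are found before `j` by induction.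
        obtain ⟨j, hj, hjmax⟩ := Finset.exists_max_image _ id hne
        simp only [Finset.mem_filter, Finset.mem_univ, true_and, id] at hj hjmax
        have hcard : openedBefore φ i = openedBefore φ j + 1 := by
          rw [openedBefore, openedBefore, ← Finset.card_insert_of_notMem (a := j) (by simp)]
          congr 1
          ext x
          simp only [Finset.mem_filter, Finset.mem_univ, true_and, Finset.mem_insert]
          constructor
          · rintro hx
            rcases (hjmax x hx).lt_or_eq with h | h
            · exact Or.inr ⟨h, hx.2⟩
            · exact Or.inl h
          · rintro (rfl | hx)
            · exact hj
            · exact ⟨hx.1.trans hj.1, hx.2⟩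
        by_cases hmj : m = openedBefore φ j
        · exact ⟨j, hj.1, hj.2, by rw [hsome j hj.2, hmj]⟩
        · obtain ⟨x, hx, hx'⟩ := ih j (by rw [← hN]; exact hj.1) j rfl (by omega)
          exact ⟨x, hx.trans hj.1, hx'⟩
    exact fun i => hex' i i rfl
  let π : SetPartition n := Finpartition.ofSetoid (Setoid.ker a)
  have hpart : ∀ i j, j ∈ π.part i ↔ a j = a i := by
    intro i j
    rw [Finpartition.mem_part_ofSetoid_iff_rel]
    exact eq_comm
  have hmin : ∀ i, φ (π.blockMin i) ≠ none ∧ a (π.blockMin i) = a i := by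
    intro i
    have h1 : a (π.blockMin i) = a i := (hpart i _).1 (Finset.min'_mem _ _)
    refine ⟨fun hno => ?_, h1⟩
    -- A minimum that opens no block would repeat the letter of an earlier position.
    obtain ⟨j, hj, -, hj'⟩ := hex _ _ ((h _).1 hno)
    have := Finset.min'_le _ _ ((hpart i j).2 (hj'.trans h1))
    exact absurd hj (not_lt.2 this)
  have hmin' : ∀ i, π.blockMin i = i ↔ φ i ≠ none := by
    intro i
    constructor
    · intro hi
      rw [← hi]
      exact (hmin i).1
    · intro hi
      by_contra hne
      have := hlt i _ hi (lt_of_le_of_ne (π.blockMin_le i) hne)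
      exact absurd (hmin i).2 this.ne
  refine ⟨π, ?_, ?_⟩
  · funext i
    by_cases hi : φ i = none
    · rw [hi, profile, if_neg]
      rw [hmin']
      simpa using hi
    · obtain ⟨s, hs⟩ := Option.ne_none_iff_exists'.1 hi
      rw [hs, profile, if_pos ((hmin' i).2 hi), ← ((h i).2 s hs).2,
        ← Finset.card_erase_add_one (π.mem_part_self i)]
      congr 3
      ext j
      simp only [Finset.mem_erase, hpart, Finset.mem_filter, Finset.mem_univ, true_and, hsome i hi]
      constructor
      · rintro ⟨h1, h2⟩
        have h3 : i < j := by
          by_contra h3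
          have := hlt i j hi (lt_of_le_of_ne (not_lt.1 h3) h1)
          rw [hsome i hi] at this
          omega
        refine ⟨h3, ?_, h2⟩
        by_contra h4
        have := hlt j i h4 h3
        rw [hsome i hi] at this
        omega
      · rintro ⟨h1, -, h2⟩
        exact ⟨h1.ne', h2⟩
  · funext i
    rw [← (hmin i).2, hsome _ (hmin i).1, openedBefore, letter]
    simp only [hmin']

/-! ### Crossings and nestings as subsequences of inner words -/

/-- For `k > 0`, partitions contain the pattern `1 2 ⋯ k σ(1) ⋯ σ(k)` if and only if there is such a
pattern starting with the smallest elements of blocks. -/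
theorem contains_append_iff {k : ℕ} (hk : 0 < k) (σ : Equiv.Perm (Fin k)) (π : SetPartition n) :
    π.Contains (Fin.append (fun i : Fin k => (i : ℕ) + 1) fun i : Fin k => (σ i : ℕ) + 1) ↔
      ∃ (i : Fin n) (g : Fin k → Fin n), StrictMono g ∧ (∀ p, i ≤ g p ∧ π.blockMin (g p) < i) ∧
        ∀ p q, π.blockMin (g p) < π.blockMin (g q) ↔ σ p < σ q := by
  constructor
  · rintro ⟨f, hf, hπ⟩
    simp only [canonicalSeq_lt_iff] at hπ
    -- The position `i` is the start of the second half, which exists because `k > 0`.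
    refine ⟨f (Fin.natAdd k ⟨0, hk⟩), fun p => f (Fin.natAdd k p), ?_, fun p => ⟨?_, ?_⟩, ?_⟩
    · intro p q hpq
      exact hf (by simpa using hpq)
    · refine hf.monotone ?_
      rw [Fin.le_def]
      simp
    · have h1 : π.blockMin (f (Fin.natAdd k p)) = π.blockMin (f (Fin.castAdd k (σ p))) := by
        refine le_antisymm (not_lt.1 ?_) (not_lt.1 ?_)
        · simp [hπ, -Fin.natAdd_eq_addNat]
        · simp [hπ, -Fin.natAdd_eq_addNat]
      rw [h1]
      refine (π.blockMin_le _).trans_lt (hf ?_)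
      rw [Fin.lt_def]
      simp
    · intro p q
      simp [hπ, -Fin.natAdd_eq_addNat]
  · rintro ⟨i, g, hg, hi, hσ⟩
    have hmin : ∀ x, π.blockMin (Fin.append (fun p => π.blockMin (g (σ.symm p))) g x) =
        π.blockMin (g (σ.symm (Fin.append id σ x))) := by
      intro x
      induction x using Fin.addCases with
      | left x => simp [blockMin_blockMin]
      | right x => simp [-Fin.natAdd_eq_addNat]
    refine ⟨Fin.append (fun p => π.blockMin (g (σ.symm p))) g, ?_, ?_⟩
    · intro x y hxy
      induction x using Fin.addCases with
      | left x =>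
        induction y using Fin.addCases with
        | left y =>
          simp only [Fin.append_left]
          rw [hσ]
          have hxy' : (x : ℕ) < y := by simpa using Fin.lt_def.1 hxy
          simpa using hxy'
        | right y =>
          simp only [Fin.append_left, Fin.append_right]
          exact (hi _).2.trans_le (hi y).1
      | right x =>
        induction y using Fin.addCases with
        | left y =>
          rw [Fin.lt_def] at hxy
          simp at hxy
          omega
        | right y =>
          simp only [Fin.append_right]
          exact hg (by simpa using hxy)
    · have hval : ∀ x, Fin.append (fun i : Fin k => (i : ℕ) + 1)
          (fun i : Fin k => (σ i : ℕ) + 1) x = (Fin.append id σ x : Fin k) + 1 := by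
        intro x
        induction x using Fin.addCases with
        | left x => simp
        | right x => simp [-Fin.natAdd_eq_addNat]
      intro x y
      rw [canonicalSeq_lt_iff, hmin, hmin, hσ, hval, hval]
      simp

end SetPartition

theorem lt_of_mem_innerWordFrom {n : ℕ} {φ : Fin n → Option ℕ} {a : Fin n → ℕ} {c x : ℕ} {i : Fin n}
    (hx : x ∈ innerWordFrom φ a c i) : x < c := by
  obtain ⟨j, hj, rfl⟩ := List.mem_map.1 hx
  have := (List.mem_filter.1 hj).2
  simp only [decide_eq_true_eq] at this
  exact this.2.2

namespace SetPartition

variable {n : ℕ}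

/-- The second half of a pattern avoids block minima, as `blockMin (g p) < i ≤ g p`. Moving `i`
right to `g 0` keeps the pattern, so only positions `i` that open no block need testing, as in
`HasProfile`. -/
theorem avoids_append_iff {k : ℕ} (hk : 0 < k) (σ : Equiv.Perm (Fin k)) (r : ℕ → ℕ → Prop)
    (π : SetPartition n)
    (hr : ∀ g : Fin k → Fin n, (∀ p q, p < q → r (π.letter (g p)) (π.letter (g q))) ↔
      ∀ p q, π.blockMin (g p) < π.blockMin (g q) ↔ σ p < σ q) :
    π.Avoids (Fin.append (fun i : Fin k => (i : ℕ) + 1) fun i : Fin k => (σ i : ℕ) + 1) ↔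
      ∀ i, π.profile i = none → ¬ ∃ l : List ℕ,
        l.Sublist (innerWordFrom π.profile π.letter (openedBefore π.profile i) i) ∧
          l.Pairwise r ∧ l.length = k := by
  rw [Avoids, contains_append_iff hk σ π]
  simp only [exists_sublist_innerWordFrom_iff, hr, letter_lt_openedBefore_iff, profile_eq_none_iff]
  constructor
  · rintro h i - ⟨g, hg, hi, hσ⟩
    exact h ⟨i, g, hg, fun p => ⟨(hi p).1, (hi p).2.2⟩, hσ⟩
  · rintro h ⟨i, g, hg, hi, hσ⟩
    have h0 : ∀ p, g ⟨0, hk⟩ ≤ g p := fun p => hg.monotone (by simp [Fin.le_def])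
    refine h (g ⟨0, hk⟩) ((hi _).2.trans_le (hi _).1) ⟨g, hg, fun p => ⟨h0 p, ?_, ?_⟩, hσ⟩
    · exact (hi p).2.trans_le (hi p).1
    · exact (hi p).2.trans_le (hi _).1

theorem forall_lt_letter_iff {k : ℕ} (π : SetPartition n) (g : Fin k → Fin n) :
    (∀ p q, p < q → π.letter (g p) < π.letter (g q)) ↔
      ∀ p q, π.blockMin (g p) < π.blockMin (g q) ↔ p < q := by
  simp only [letter_lt_iff]
  exact ⟨fun h p q => StrictMono.lt_iff_lt (f := fun p => π.blockMin (g p)) fun p q => h p q,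
    fun h p q => (h p q).2⟩

theorem forall_gt_letter_iff {k : ℕ} (π : SetPartition n) (g : Fin k → Fin n) :
    (∀ p q, p < q → π.letter (g p) > π.letter (g q)) ↔
      ∀ p q, π.blockMin (g p) < π.blockMin (g q) ↔ p.rev < q.rev := by
  simp only [letter_lt_iff, gt_iff_lt, Fin.rev_lt_rev]
  exact ⟨fun h p q => StrictAnti.lt_iff_gt (f := fun p => π.blockMin (g p)) fun p q => h p q,
    fun h p q => (h q p).2⟩

theorem isNoncrossing_succ_iff {K : ℕ} {π : SetPartition n} : π.IsNoncrossing (K + 1) ↔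
    ∀ i, π.profile i = none → InsertionRule.row.Short K (openedBefore π.profile i)
      (innerWordFrom π.profile π.letter (openedBefore π.profile i) i) := by
  rw [IsNoncrossing, crossingPattern]
  refine (avoids_append_iff K.succ_pos 1 (· < ·) π (π.forall_lt_letter_iff)).trans ?_
  refine forall_congr' fun i => imp_congr_right fun _ => ?_
  rw [InsertionRule.Short, InsertionRule.topShape_row_tableau_eq_zero_iff, ← Nat.lt_succ_iff,
    ← not_le, le_increasingLength_iff]
  · simp
  · exact fun x hx => lt_of_mem_innerWordFrom hx

theorem isNonnesting_succ_iff {K : ℕ} {π : SetPartition n} : π.IsNonnesting (K + 1) ↔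
    ∀ i, π.profile i = none → InsertionRule.column.Short K (openedBefore π.profile i)
      (innerWordFrom π.profile π.letter (openedBefore π.profile i) i) := by
  rw [IsNonnesting, nestingPattern]
  refine (avoids_append_iff K.succ_pos Fin.revPerm (· > ·) π (π.forall_gt_letter_iff)).trans ?_
  refine forall_congr' fun i => imp_congr_right fun _ => ?_
  have hlt : ∀ x ∈ innerWordFrom π.profile π.letter (openedBefore π.profile i) i,
      x < openedBefore π.profile i := fun x hx => lt_of_mem_innerWordFrom hx
  rw [InsertionRule.Short, InsertionRule.topShape_column_tableau_eq_zero_iff hlt,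
    ← Nat.lt_succ_iff, ← not_le, le_decreasingLength_iff, not_iff_not]
  refine exists_congr fun l => ?_
  constructor
  · rintro ⟨h1, h2, h3⟩
    exact ⟨h1, h2, fun x hx => hlt x (h1.subset hx), h3⟩
  · rintro ⟨h1, h2, -, h3⟩
    exact ⟨h1, h2, h3⟩

/-! ### Bijections for each profile and their union -/

theorem nonempty_equiv_hasProfile (P : SetPartition n → Prop) (ok : ℕ → List ℕ → Prop)
    (hP : ∀ π, P π ↔ ∀ i, π.profile i = none → ok (openedBefore π.profile i)
      (innerWordFrom π.profile π.letter (openedBefore π.profile i) i))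
    (φ : Fin n → Option ℕ) :
    Nonempty ({π : {π : SetPartition n // P π} // π.1.profile = φ} ≃
      {w // HasProfile ok 0 (List.ofFn φ) w}) := by
  have key : ∀ π : SetPartition n, HasProfile ok 0 (List.ofFn π.profile) (List.ofFn π.letter) ↔
      P π := by
    intro π
    rw [hasProfile_ofFn_iff, hP]
    refine forall_congr' fun i => ?_
    have := π.isLetterOf_letter i
    simp only [zero_add]
    tauto
  refine ⟨Equiv.ofBijective (fun π => ⟨List.ofFn π.1.1.letter, ?_⟩) ⟨?_, ?_⟩⟩
  · obtain ⟨⟨π, hπ⟩, rfl⟩ := π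
    exact (key π).2 hπ
  · rintro ⟨⟨π, hπ⟩, h⟩ ⟨⟨π', hπ'⟩, h'⟩ he
    have := letter_injective (List.ofFn_injective (congrArg Subtype.val he))
    simpa using this
  · rintro ⟨w, hw⟩
    obtain ⟨a, rfl⟩ : ∃ a : Fin n → ℕ, List.ofFn a = w := by
      have hl := hw.length_eq
      rw [List.length_ofFn] at hl
      subst hl
      exact ⟨w.get, List.ofFn_get w⟩
    have ha : IsLetterOf φ a := by
      rw [hasProfile_ofFn_iff] at hw
      intro i
      have := hw i
      simp only [zero_add] at this
      tauto
    obtain ⟨π, rfl, rfl⟩ := exists_letter_eq ha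
    exact ⟨⟨⟨π, (key π).1 hw⟩, rfl⟩, rfl⟩

/-- For each profile, there are as many partitions without a `k`-crossing as there are partitions
without a `k`-nesting. -/
theorem nonempty_fiber_profile_equiv (k : ℕ) (φ : Fin n → Option ℕ) :
    Nonempty ({π : {π : SetPartition n // π.IsNoncrossing k} // π.1.profile = φ} ≃
      {π : {π : SetPartition n // π.IsNonnesting k} // π.1.profile = φ}) := by
  cases k with
  | zero =>
    -- For `k = 0` the pattern is empty and contained in every partition, so both sides are empty.
    have h : ∀ (π : SetPartition n) (s : Fin (0 + 0) → ℕ), ¬ π.Avoids s := by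
      intro π s hs
      exact hs ⟨fun i => i.elim0, fun i => i.elim0, fun i => i.elim0⟩
    have : IsEmpty {π : SetPartition n // π.IsNoncrossing 0} := ⟨fun π => h π.1 _ π.2⟩
    have : IsEmpty {π : SetPartition n // π.IsNonnesting 0} := ⟨fun π => h π.1 _ π.2⟩
    exact ⟨Equiv.equivOfIsEmpty _ _⟩
  | succ K =>
    obtain ⟨e⟩ := nonempty_equiv_hasProfile _ _ (fun π => isNoncrossing_succ_iff (K := K)) φ
    obtain ⟨e'⟩ := nonempty_equiv_hasProfile _ _ (fun π => isNonnesting_succ_iff (K := K)) φ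
    obtain ⟨f⟩ := InsertionRule.nonempty_hasProfile_equiv InsertionRule.row InsertionRule.column K
      (List.ofFn φ)
    exact ⟨e.trans (f.trans e'.symm)⟩

theorem card_parts_eq_card_filter_profile (π : SetPartition n) :
    π.parts.card = (Finset.univ.filter fun i => π.profile i ≠ none).card := by
  symm
  refine Finset.card_bij (fun i _ => π.part i) (fun i _ => π.part_mem.2 (Finset.mem_univ i)) ?_ ?_
  · intro i hi j hj h
    simp only [Finset.mem_filter, Finset.mem_univ, true_and, profile_ne_none_iff] at hi hj
    rw [← hi, ← hj, blockMin_eq_iff, h]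
  · intro B hB
    obtain ⟨i, hi⟩ := π.nonempty_of_mem_parts hB
    refine ⟨π.blockMin i, ?_, ?_⟩
    · simp [profile_ne_none_iff, blockMin_blockMin]
    · rw [part_blockMin, π.part_eq_of_mem hB hi]

theorem exists_block_of_profile_eq {π π' : SetPartition n} (h : π'.profile = π.profile)
    {B : Finset (Fin n)} (hB : B ∈ π.parts) :
    ∃ B' ∈ π'.parts, B'.card = B.card ∧ B'.min = B.min := by
  obtain ⟨i, hi⟩ := π.nonempty_of_mem_parts hB
  obtain rfl := π.part_eq_of_mem hB hi
  have h1 : π.profile (π.blockMin i) = some (π.part i).card := by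
    rw [profile, if_pos (π.blockMin_blockMin i), part_blockMin]
  rw [← h] at h1
  have h2 : π'.blockMin (π.blockMin i) = π.blockMin i := profile_ne_none_iff.1 (by simp [h1])
  rw [profile, if_pos h2, Option.some.injEq] at h1
  refine ⟨π'.part (π.blockMin i), π'.part_mem.2 (Finset.mem_univ _), h1, ?_⟩
  rw [← coe_blockMin, ← coe_blockMin, h2]

end SetPartition

theorem theorem3p8 (n k : ℕ) :
    Nat.card {π : SetPartition n // π.IsNoncrossing k} =
        Nat.card {π : SetPartition n // π.IsNonnesting k} ∧
      ∃ e : {π : SetPartition n // π.IsNoncrossing k} ≃ {π : SetPartition n // π.IsNonnesting k},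
        ∀ π : {π : SetPartition n // π.IsNoncrossing k},
          (e π).1.parts.card = π.1.parts.card ∧
          ∀ B ∈ π.1.parts, ∃ B' ∈ (e π).1.parts, B'.card = B.card ∧ B'.min = B.min := by
  obtain ⟨e, he⟩ : ∃ e : {π : SetPartition n // π.IsNoncrossing k} ≃
      {π : SetPartition n // π.IsNonnesting k}, ∀ π, (e π).1.profile = π.1.profile := by
    -- The bijections chosen for the single profiles are glued into one that preserves the profile.
    refine ⟨Equiv.ofFiberEquiv (f := fun π => π.1.profile) (g := fun π => π.1.profile) fun φ =>
      (SetPartition.nonempty_fiber_profile_equiv k φ).some, fun π => ?_⟩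
    exact Equiv.ofFiberEquiv_map (f := fun π : {π : SetPartition n // π.IsNoncrossing k} =>
      π.1.profile) (g := fun π : {π : SetPartition n // π.IsNonnesting k} => π.1.profile) _ π
  refine ⟨Nat.card_congr e, e, fun π => ⟨?_, fun B hB => ?_⟩⟩
  · rw [SetPartition.card_parts_eq_card_filter_profile, he,
      SetPartition.card_parts_eq_card_filter_profile]
  · exact SetPartition.exists_block_of_profile_eq (he π) hB
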